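/- Let $\epsilon\in\mathbb Z$ and put $$\phi_\epsilon(z_2,z_0)=e^{z_0\left(z_2^{\epsilon}\frac{d}{dz_2}\right)}z_2\in\mathbb C((z_2))[[z_0]].$$ Let $V=(V,Y,\mathbf 1)$ be a vertex algebra over $\mathbb C$, with $Y(u,z)=\sum_{n\in\mathbb Z}u_nz^{-n-1}$. A $\phi_\epsilon$-coordinated $V$-module is a complex vector space $W$ with a linear map $Y_W^\epsilon(\cdot,z):V\to\mathrm{Hom}(W,W((z)))$ such that $Y_W^\epsilon(\mathbf 1,z)=1_W$ and such that for all $u,v\in V$ there is $k\in\mathbb N$ with $$(z_1-z_2)^kY_W^\epsilon(u,z_1)Y_W^\epsilon(v,z_2)\in\mathrm{Hom}(W,W((z_1,z_2))),$$ $$(\phi_\epsilon(z_2,z_0)-z_2)^kY_W^\epsilon(Y(u,z_0)v,z_2)=\left((z_1-z_2)^kY_W^\epsilon(u,z_1)Y_W^\epsilon(v,z_2)\right)\big|_{z_1=\phi_\epsilon(z_2,z_0)}.$$ For $A(z)=\sum_{m\in\mathbb Z}A_{(m)}z^m$ and $B(z)$ in $\mathrm{Hom}(W,W((z)))$ set $${}_\circ^\circ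 A(z)B(z){}_\circ^\circ=\Big(\sum_{m\ge0}A_{(m)}z^m\Big)B(z)+B(z)\Big(\sum_{m<0}A_{(m)}z^m\Big).$$ For $m\ge 0$ put $\epsilon^{(m)}=\prod_{s=0}^{m-1}(\epsilon+s(\epsilon-1))$ (so $\epsilon^{(0)}=1$), put $h_0=1$, and for $n\ge1$ $$h_n=\sum_{\substack{r_1,\dots,r_n\ge0\\ r_1+2r_2+\cdots+nr_n=n}}(-1)^{\sum_{m=1}^n r_m}\Big(\sum_{m=1}^nr_m\Big)!\prod_{m=1}^n\frac1{r_m!}\left(\frac{\epsilon^{(m)}}{(m+1)!}\right)^{r_m}.$$ **Proposition.** Let $(W,Y_W^\epsilon)$ be a $\phi_\epsilon$-coordinated $V$-module. Then for all $u,v\in V$, $$Y_W^\epsilon(u_{-1}v,z)={}_\circ^\circ Y_W^\epsilon(u,z)Y_W^\epsilon(v,z){}_\circ^\circ-\sum_{n\ge0}\sum_{i=0}^{n+1}\frac1{i!}\,\epsilon^{(i)}\,h_{n-i+1}\,z^{(n+1)(\epsilon-1)}\,Y_W^\epsilon(u_nv,z).$$ -/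

import Mathlib

noncomputable section

namespace PhiCoord

/-! ## Vertex algebras -/

/-- A vertex algebra `(V, Y, 𝟏)` over `ℂ`. The vertex operator map is a linear map
`Y : V → Hom(V, V((z)))` and `u_n = (Y u)[[n]]` is the coefficient of `z ^ (-n-1)` in `Y(u, z)`.
The axioms are the vacuum property, the creation property and the Jacobi identity, the latter
written as the equality of all the coefficients of its two sides. All the sums in it are finite,
because `Y` takes values in `Hom(V, V((z)))`. -/
structure VertexAlgebra (V : Type*) [AddCommGroup V] [Module ℂ V] where
  /-- The vertex operator map. -/
  Y : V →ₗ[ℂ] VertexOperator ℂ V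
  /-- The vacuum vector. -/
  vac : V
  /-- `Y(𝟏, z) v = v`. -/
  vacuum : ∀ v : V, Y vac v = HahnModule.of ℂ (HahnSeries.single 0 v)
  /-- `Y(v, z) 𝟏` has no negative powers of `z`. -/
  creation : ∀ (v : V) (n : ℤ), 0 ≤ n → VertexOperator.ncoeff (Y v) n vac = 0
  /-- The constant term of `Y(v, z) 𝟏` is `v`. -/
  creation_const : ∀ v : V, VertexOperator.ncoeff (Y v) (-1) vac = v
  /-- The Jacobi identity
  `z₀⁻¹ δ((z₁ - z₂)/z₀) Y(u, z₁) Y(v, z₂) w - z₀⁻¹ δ((z₂ - z₁)/(-z₀)) Y(v, z₂) Y(u, z₁) w`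
  `= z₂⁻¹ δ((z₁ - z₀)/z₂) Y(Y(u, z₀) v, z₂) w`,
  at the coefficient of `z₀ ^ (-l-1) z₁ ^ (-m-1) z₂ ^ (-n-1)`. -/
  jacobi : ∀ (u v w : V) (l m n : ℤ),
    (∑ᶠ i : ℕ, ((-1 : ℤ) ^ i * Ring.choose l i) •
        VertexOperator.ncoeff (Y u) (m + l - i) (VertexOperator.ncoeff (Y v) (n + i) w))
      - (∑ᶠ i : ℕ, ((-1 : ℤ) ^ i * Ring.choose l i * (Int.negOnePow l : ℤ)) •
        VertexOperator.ncoeff (Y v) (n + l - i) (VertexOperator.ncoeff (Y u) (m + i) w))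
      = ∑ᶠ i : ℕ, Ring.choose m i •
        VertexOperator.ncoeff (Y (VertexOperator.ncoeff (Y u) (l + i) v)) (m + n - i) w

/-! ## Formal series in two variables -/

/-- Multiplication by `z₁ - z₂` on `M[[z₁^±1, z₂^±1]]`; a series is given by its coefficients,
`F m n` being the coefficient of `z₁ ^ m z₂ ^ n`. -/
def mulSub {M : Type*} [AddCommGroup M] (F : ℤ → ℤ → M) : ℤ → ℤ → M :=
  fun m n => F (m - 1) n - F m (n - 1)

/-- `F` lies in `M((z₁, z₂))`: the powers of both variables are bounded below. -/
def IsLaurent₂ {M : Type*} [AddCommGroup M] (F : ℤ → ℤ → M) : Prop :=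
  ∃ N : ℤ, ∀ m n : ℤ, m < N ∨ n < N → F m n = 0

/-- The coefficients of `A(z₁) B(z₂) w`. -/
def prodSeries {W : Type*} [AddCommGroup W] [Module ℂ W]
    (A B : VertexOperator ℂ W) (w : W) : ℤ → ℤ → W :=
  fun m n => HVertexOperator.coeff A m (HVertexOperator.coeff B n w)

/-! ## The associate `φ_ε` -/

/-- The derivation `z ^ ε d/dz` of `ℂ((z))`. -/
def epsDeriv (ε : ℤ) (f : LaurentSeries ℂ) : LaurentSeries ℂ :=
  HahnSeries.single ε 1 * LaurentSeries.derivative ℂ f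

/-- `φ_ε(z₂, z₀) = exp(z₀ z₂ ^ ε d/dz₂) z₂`, an element of `ℂ((z₂))[[z₀]]`, regarded as an element
of the field `ℂ((z₂))((z₀))`. The outer variable is `z₀`, the inner variable is `z₂`. -/
def phi (ε : ℤ) : LaurentSeries (LaurentSeries ℂ) :=
  HahnSeries.ofPowerSeries ℤ (LaurentSeries ℂ)
    (PowerSeries.mk fun j : ℕ => ((j.factorial : ℂ)⁻¹) • (epsDeriv ε)^[j] (HahnSeries.single 1 1))

/-- The element `z₂` of `ℂ((z₂))((z₀))`. -/
def z₂ : LaurentSeries (LaurentSeries ℂ) := HahnSeries.C (HahnSeries.single 1 1)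

/-- `F(z₁, z₂)` at `z₁ = φ_ε(z₂, z₀)` for `F` in `W((z₁, z₂))`: each `z₁ ^ m z₂ ^ n` is replaced by
`φ_ε(z₂, z₀) ^ m z₂ ^ n`. The value at `j p` is the coefficient of `z₀ ^ j z₂ ^ p`; it is a finite
sum, as the coefficient of `z₀ ^ j` in `φ_ε(z₂, z₀) ^ m` is a multiple of
`z₂ ^ (m + j (ε - 1))`. -/
def substPhi {W : Type*} [AddCommGroup W] [Module ℂ W] (ε : ℤ) (F : ℤ → ℤ → W) : ℤ → ℤ → W :=
  fun j p => ∑ᶠ q : ℤ × ℤ, (((phi ε) ^ q.1).coeff j).coeff (p - q.2) • F q.1 q.2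

/-- The product of `f` in `ℂ((z₂))((z₀))` with a series `G` in `z₀, z₂` with coefficients in `W`
(`G j p` is the coefficient of `z₀ ^ j z₂ ^ p`). -/
def scalarMul {W : Type*} [AddCommGroup W] [Module ℂ W]
    (f : LaurentSeries (LaurentSeries ℂ)) (G : ℤ → ℤ → W) : ℤ → ℤ → W :=
  fun j p => ∑ᶠ q : ℤ × ℤ, ((f.coeff q.1).coeff q.2) • G (j - q.1) (p - q.2)

/-! ## `φ_ε`-coordinated modules -/

/-- The coefficients of `Y_W(Y(u, z₀) v, z₂) w`: the value at `j p` is the coefficient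
of `z₀ ^ j z₂ ^ p`. -/
def iterSeries {V W : Type*} [AddCommGroup V] [Module ℂ V] [AddCommGroup W] [Module ℂ W]
    (𝒱 : VertexAlgebra V) (YW : V →ₗ[ℂ] VertexOperator ℂ W) (u v : V) (w : W) : ℤ → ℤ → W :=
  fun j p => HVertexOperator.coeff (YW (HVertexOperator.coeff (𝒱.Y u) j v)) p w

/-- A `φ_ε`-coordinated module for the vertex algebra `𝒱` on the vector space `W`. -/
structure PhiModule (ε : ℤ) {V : Type*} [AddCommGroup V] [Module ℂ V] (𝒱 : VertexAlgebra V)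
    (W : Type*) [AddCommGroup W] [Module ℂ W] where
  /-- The linear map `Y_W : V → Hom(W, W((z)))`. -/
  YW : V →ₗ[ℂ] VertexOperator ℂ W
  /-- `Y_W(𝟏, z) = 1_W`. -/
  vacuum : ∀ w : W, YW 𝒱.vac w = HahnModule.of ℂ (HahnSeries.single 0 w)
  /-- For all `u, v` there is `k` with
  `(z₁ - z₂) ^ k Y_W(u, z₁) Y_W(v, z₂)` in `Hom(W, W((z₁, z₂)))` and
  `(φ_ε(z₂, z₀) - z₂) ^ k Y_W(Y(u, z₀) v, z₂)`
  `= ((z₁ - z₂) ^ k Y_W(u, z₁) Y_W(v, z₂))` at `z₁ = φ_ε(z₂, z₀)`. -/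
  assoc : ∀ u v : V, ∃ k : ℕ,
    (∀ w : W, IsLaurent₂ (mulSub^[k] (prodSeries (YW u) (YW v) w))) ∧
    (∀ w : W, scalarMul ((phi ε - z₂) ^ k) (iterSeries 𝒱 YW u v w)
      = substPhi ε (mulSub^[k] (prodSeries (YW u) (YW v) w)))

/-! ## Normally ordered products and the coefficients of the formula -/

section NormalOrder

variable {W : Type*} [AddCommGroup W] [Module ℂ W]

/-- The coefficients of a vertex operator, applied to a vector, vanish in low degrees. -/
lemma exists_coeff_eq_zero (A : VertexOperator ℂ W) (w : W) :
    ∃ N : ℤ, ∀ n < N, HVertexOperator.coeff A n w = 0 :=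
  ⟨_, fun n hn => VertexOperator.coeff_eq_zero_of_lt_order A n w hn⟩

lemma finite_support_fst (A B : VertexOperator ℂ W) (p : ℤ) (w : W) :
    (Function.support fun m : ℕ =>
      HVertexOperator.coeff A m (HVertexOperator.coeff B (p - m) w)).Finite := by
  obtain ⟨N, hN⟩ := exists_coeff_eq_zero B w
  refine (Set.finite_Iic (p - N).toNat).subset fun m hm => ?_
  by_contra h
  refine hm ?_
  simp only [Set.mem_Iic, not_le] at h
  simp only
  rw [hN _ (by omega), map_zero]

lemma finite_support_snd (A B : VertexOperator ℂ W) (p : ℤ) (w : W) :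
    (Function.support fun m : ℕ =>
      HVertexOperator.coeff B (p + m + 1) (HVertexOperator.coeff A (-m - 1) w)).Finite := by
  obtain ⟨N, hN⟩ := exists_coeff_eq_zero A w
  refine (Set.finite_Iic (-N).toNat).subset fun m hm => ?_
  by_contra h
  refine hm ?_
  simp only [Set.mem_Iic, not_le] at h
  simp only
  rw [hN _ (by omega), map_zero]

/-- The coefficient of `z ^ p` in `A⁺(z) B(z) + B(z) A⁻(z)`, where `A⁺(z)` is the part of `A(z)`
with the powers `z ^ m`, `0 ≤ m`, and `A⁻(z)` the part with the powers `z ^ (-m-1)`, `0 ≤ m`. The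
sums are finite on each vector. -/
def normalOrderCoeff (A B : VertexOperator ℂ W) (p : ℤ) : Module.End ℂ W where
  toFun w :=
    (∑ᶠ m : ℕ, HVertexOperator.coeff A m (HVertexOperator.coeff B (p - m) w))
      + ∑ᶠ m : ℕ, HVertexOperator.coeff B (p + m + 1) (HVertexOperator.coeff A (-m - 1) w)
  map_add' x y := by
    simp only [map_add]
    rw [finsum_add_distrib (finite_support_fst A B p x) (finite_support_fst A B p y),
      finsum_add_distrib (finite_support_snd A B p x) (finite_support_snd A B p y)]
    abel
  map_smul' c x := by
    simp only [map_smul, RingHom.id_apply, smul_add]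
    rw [smul_finsum' c (finite_support_fst A B p x), smul_finsum' c (finite_support_snd A B p x)]

lemma normalOrderCoeff_bddBelow (A B : VertexOperator ℂ W) (w : W) :
    BddBelow (Function.support fun p : ℤ => normalOrderCoeff A B p w) := by
  obtain ⟨N, hN⟩ := exists_coeff_eq_zero B w
  obtain ⟨M, hM⟩ := exists_coeff_eq_zero A w
  have key : ∃ K : ℤ, ∀ m : ℕ, ∀ q < K,
      HVertexOperator.coeff B q (HVertexOperator.coeff A (-m - 1) w) = 0 := by
    choose K hK using fun m : ℕ =>
      exists_coeff_eq_zero B (HVertexOperator.coeff A (-(m : ℤ) - 1) w)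
    obtain ⟨L, hL⟩ := ((Set.finite_Iic (-M).toNat).image K).bddBelow
    refine ⟨L, fun m q hq => ?_⟩
    by_cases hm : m ≤ (-M).toNat
    · exact hK m q (hq.trans_le (hL ⟨m, hm, rfl⟩))
    · rw [hM _ (by omega), map_zero]
  obtain ⟨K, hK⟩ := key
  refine ⟨min N (K - (-M).toNat - 1), fun p hp => ?_⟩
  by_contra h
  refine hp ?_
  have h1 : p < N := by
    have := min_le_left N (K - (-M).toNat - 1)
    omega
  have h2 : p < K - (-M).toNat - 1 := by
    have := min_le_right N (K - (-M).toNat - 1)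
    omega
  have e1 : (∑ᶠ m : ℕ, HVertexOperator.coeff A m (HVertexOperator.coeff B (p - m) w)) = 0 := by
    refine finsum_eq_zero_of_forall_eq_zero fun m => ?_
    rw [hN _ (by omega), map_zero]
  have e2 : (∑ᶠ m : ℕ, HVertexOperator.coeff B (p + m + 1)
      (HVertexOperator.coeff A (-m - 1) w)) = 0 := by
    refine finsum_eq_zero_of_forall_eq_zero fun m => ?_
    by_cases hm : m ≤ (-M).toNat
    · exact hK m _ (by omega)
    · rw [hM _ (by omega), map_zero]
  change (∑ᶠ m : ℕ, HVertexOperator.coeff A m (HVertexOperator.coeff B (p - m) w))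
      + (∑ᶠ m : ℕ, HVertexOperator.coeff B (p + m + 1) (HVertexOperator.coeff A (-m - 1) w)) = 0
  rw [e1, e2, add_zero]

/-- The normally ordered product `:A(z) B(z): = A⁺(z) B(z) + B(z) A⁻(z)`, as an element of
`Hom(W, W((z)))`. -/
def normalOrder (A B : VertexOperator ℂ W) : VertexOperator ℂ W :=
  VertexOperator.of_coeff (normalOrderCoeff A B) (normalOrderCoeff_bddBelow A B)

/-- `z ^ k A(z)` for an integer `k`. -/
def zpowMul (k : ℤ) (A : VertexOperator ℂ W) : VertexOperator ℂ W :=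
  VertexOperator.of_coeff (fun p => HVertexOperator.coeff A (p - k)) fun w => by
    obtain ⟨N, hN⟩ := exists_coeff_eq_zero A w
    refine ⟨N + k, fun p hp => ?_⟩
    by_contra h
    exact hp (hN _ (by omega))

end NormalOrder

/-- `ε^{(m)} = ∏_{s=0}^{m-1} (ε + s (ε - 1))`. -/
def epsFac (ε : ℤ) (m : ℕ) : ℂ := ∏ s ∈ Finset.range m, ((ε : ℂ) + s * ((ε : ℂ) - 1))

/-- The number `h_n`: the sum, over all `r_1, …, r_n ≥ 0` with `r_1 + 2 r_2 + ⋯ + n r_n = n`, of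
`(-1)^{∑ r_m} (∑ r_m)! ∏_m (1 / r_m!) (ε^{(m)} / (m+1)!)^{r_m}`. The index `m : Fin n` stands for
`m + 1`; the constraint forces each `r_m ≤ n`, so the sum runs over all solutions. For `n = 0` the
sum has one term, and `h_0 = 1`. -/
def hCoeff (ε : ℤ) (n : ℕ) : ℂ :=
  ∑ r ∈ (Fintype.piFinset fun _ : Fin n => Finset.range (n + 1)) with
      ∑ m : Fin n, ((m : ℕ) + 1) * r m = n,
    (-1 : ℂ) ^ (∑ m, r m) * ((∑ m, r m).factorial : ℂ) *
      ∏ m : Fin n, (1 / ((r m).factorial : ℂ)) *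
        (epsFac ε ((m : ℕ) + 1) / (((m : ℕ) + 2).factorial : ℂ)) ^ (r m)

lemma hCoeff_zero (ε : ℤ) : hCoeff ε 0 = 1 := by
  simp [hCoeff]

end PhiCoord

end

/-!
The formula is a residue theorem on the projective line. With `d = ε - 1`, `x = z₀ z₂ ^ d` and
`y = z₁ / z₂`, everything in sight is homogeneous: `φ_ε(z₂, z₀) = z₂ g(x)` for a power series
`g = flow d 1` in one variable with `g(0) = 1`. Fix `w` in `W`, a linear functional on `W` and a total
degree `t`. Then the products `Y_W(u, z₁) Y_W(v, z₂)` and `Y_W(v, z₂) Y_W(u, z₁)` become series `P(y)`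
and `Q(y)`, with powers of `y` bounded above and below respectively, the iterate
`Y_W(Y(u, z₀) v, z₂)` becomes a Laurent series `G(x)`, and the module axiom reads
`(g(x) - 1) ^ k G(x) = f(g(x))` with the Laurent polynomial `f(y) = (y - 1) ^ k P(y)`
(`exists_one_variable_relation`).

The product in the opposite order satisfies `(y - 1) ^ K Q(y) = (y - 1) ^ K P(y)`
(`exists_common_relation`). This comes from skew-symmetry of the vertex algebra
(`coeff_skew_symmetry`), from `Y_W(Y(a, z₀) 𝟏, z₂) = Y_W(a, φ_ε(z₂, z₀))` (`coeff_YW_coeff_vac`), and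
from the substitution `reversal`, which inverts `g` (`subst_flow`, `reversed_relation`).

So `P`, `Q` and `G` are the expansions at `y = ∞`, at `y = 0`, and at `y = 1` in the coordinate `x`, of
one rational function of `y`. Divide it by `y - 1`: the residues at `∞` and at `0` add up to the coefficient
of the normally ordered product (`halfSum_iterate_mulSubOne`), up to sign, and the residue at `1` is
that of `g'(x) / (g(x) - 1) * G(x)` (`coeff_zero_eq_finsum_choose`). Finally
`x g' / (g - 1) = (∑ ε^{(m)} x ^ m / m!) (∑ h_n x ^ n)` by the multinomial theorem
(`coeff_inv_flowQuot`), which gives the coefficients in the formula.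
-/

noncomputable section

namespace PhiCoord

open PowerSeries Finset

/-! ### The powers of `φ_ε` as one-variable power series -/

/-- The power series `∑_j a (a + d) ⋯ (a + (j - 1) d) x ^ j / j!`, that is, `(1 - d x) ^ (-a/d)` if
`d ≠ 0` and `exp (a x)` if `d = 0`. For `d = ε - 1` and `m : ℤ`, the power `φ_ε(z₂, z₀) ^ m` is
`z₂ ^ m` times this series with `a = m`, at `x = z₀ z₂ ^ (ε - 1)`. -/
def flow (d a : ℂ) : ℂ⟦X⟧ :=
  PowerSeries.mk fun j => (∏ s ∈ range j, (a + s * d)) / (j.factorial : ℂ)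

lemma coeff_flow (d a : ℂ) (j : ℕ) :
    coeff j (flow d a) = (∏ s ∈ range j, (a + s * d)) / (j.factorial : ℂ) :=
  coeff_mk _ _

@[simp]
lemma constantCoeff_flow (d a : ℂ) : constantCoeff (flow d a) = 1 := by
  rw [← coeff_zero_eq_constantCoeff_apply, coeff_flow]
  simp

lemma coeff_one_sub_mul_derivative (d : ℂ) (f : ℂ⟦X⟧) (n : ℕ) :
    coeff n ((1 - C d * X) * derivative ℂ f) = coeff (n + 1) f * (n + 1) - d * n * coeff n f := by
  rw [sub_mul, one_mul, map_sub, coeff_derivative, mul_assoc, coeff_C_mul]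
  cases n with
  | zero => simp
  | succ n =>
    rw [coeff_succ_X_mul, coeff_derivative]
    push_cast
    ring

/-- Together with the constant term `1`, this equation determines `flow d a`; all the identities
between these series follow from it. -/
lemma flow_ode (d a : ℂ) : (1 - C d * X) * derivative ℂ (flow d a) = C a * flow d a := by
  ext n
  rw [coeff_one_sub_mul_derivative, coeff_C_mul, coeff_flow, coeff_flow, prod_range_succ,
    Nat.factorial_succ]
  have h : (n.factorial : ℂ) ≠ 0 := by exact_mod_cast n.factorial_ne_zero
  have h' : (n : ℂ) + 1 ≠ 0 := by exact_mod_cast n.succ_ne_zero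
  generalize ∏ s ∈ range n, (a + s * d) = p
  push_cast
  field_simp
  ring

lemma eq_flow {d a : ℂ} {f : ℂ⟦X⟧} (h0 : constantCoeff f = 1)
    (h : (1 - C d * X) * derivative ℂ f = C a * f) : f = flow d a := by
  ext n
  induction n with
  | zero => simp [h0]
  | succ n ih =>
    have h1 := congrArg (coeff n) h
    have h2 := congrArg (coeff n) (flow_ode d a)
    rw [coeff_one_sub_mul_derivative, coeff_C_mul] at h1 h2
    have h' : (n : ℂ) + 1 ≠ 0 := by exact_mod_cast n.succ_ne_zero
    refine mul_right_cancel₀ h' ?_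
    rw [ih] at h1
    linear_combination h1 - h2

lemma flow_mul (d a b : ℂ) : flow d a * flow d b = flow d (a + b) := by
  refine eq_flow (by simp) ?_
  rw [Derivation.leibniz, smul_eq_mul, smul_eq_mul, map_add]
  linear_combination flow d a * flow_ode d b + flow d b * flow_ode d a

@[simp]
lemma flow_zero (d : ℂ) : flow d 0 = 1 :=
  (eq_flow (by simp) (by simp)).symm

lemma flow_neg_self (d : ℂ) : flow d (-d) = 1 - C d * X :=
  (eq_flow (by simp) (by simp [Derivation.leibniz, mul_comm])).symm

lemma flow_pow (d a : ℂ) (n : ℕ) : flow d a ^ n = flow d (n * a) := by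
  induction n with
  | zero => simp
  | succ n ih => rw [pow_succ, ih, flow_mul]; congr 1; push_cast; ring

lemma derivative_flow_one (d : ℂ) : derivative ℂ (flow d 1) = flow d (1 + d) := by
  have h := flow_ode d 1
  have h2 := flow_mul d (-d) d
  rw [← flow_neg_self] at h
  rw [neg_add_cancel, flow_zero] at h2
  rw [← flow_mul]
  rw [map_one] at h
  linear_combination flow d d * h - derivative ℂ (flow d 1) * h2

/-- The substitution `x ↦ -x (flow d d)` that exchanges the two variables: if `z₁ = φ_ε(z₂, z₀)` then
`z₂ = φ_ε(z₁, -z₀)`, and `-z₀ z₁ ^ (ε - 1)` is this series at `x = z₀ z₂ ^ (ε - 1)`. -/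
def reversal (d : ℂ) : ℂ⟦X⟧ := -(X * flow d d)

lemma hasSubst_reversal (d : ℂ) : HasSubst (reversal d) :=
  HasSubst.of_constantCoeff_zero' (by simp [reversal])

lemma subst_flow (d a : ℂ) : (flow d a).subst (reversal d) = flow d (-a) := by
  have hs := hasSubst_reversal d
  have hinv : flow d d * flow d (-d) = 1 := by rw [flow_mul, add_neg_cancel, flow_zero]
  have hCs (c : ℂ) (f : ℂ⟦X⟧) : (C c * f).subst (reversal d) = C c * f.subst (reversal d) := by
    rw [← smul_eq_C_mul, subst_smul hs, smul_eq_C_mul]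
  have h1 : (1 : ℂ⟦X⟧).subst (reversal d) = 1 := by
    rw [← coe_substAlgHom hs, map_one]
  have hsub : (1 - C d * X : ℂ⟦X⟧).subst (reversal d) = flow d d := by
    rw [subst_sub hs, hCs, subst_X hs, h1, reversal]
    have := flow_neg_self d
    linear_combination flow d d * this - hinv
  refine eq_flow ?_ ?_
  · rw [← coeff_zero_eq_constantCoeff_apply, coeff_subst' hs, finsum_eq_single _ 0]
    · simp
    · intro n hn
      simp [reversal, hn]
  · have h := congrArg (subst (reversal d)) (flow_ode d a)
    rw [subst_mul hs, hsub, hCs] at h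
    rw [derivative_subst hs]
    have hx : derivative ℂ (reversal d) = -(flow d d * flow d d) := by
      have h3 := flow_ode d d
      rw [← flow_neg_self] at h3
      rw [reversal, map_neg, Derivation.leibniz, derivative_X, smul_eq_mul, smul_eq_mul]
      have h4 : derivative ℂ (flow d d) = C d * flow d d * flow d d := by
        linear_combination flow d d * h3 - derivative ℂ (flow d d) * hinv
      have h5 := flow_neg_self d
      rw [h4]
      linear_combination (-flow d d * flow d d) * h5 + flow d d * hinv
    rw [hx, ← flow_neg_self, map_neg]
    linear_combination (-1 : ℂ⟦X⟧) * h -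
      (derivative ℂ (flow d a)).subst (reversal d) * flow d d * hinv

/-- The series `flow d m` are eigenvectors of `(1 - d x) d/dx` with the distinct eigenvalues `m`. -/
lemma linearIndependent_flow (d : ℂ) :
    LinearIndependent ℂ fun m : ℤ => flow d (m : ℂ) := by
  let T : Module.End ℂ ℂ⟦X⟧ :=
    LinearMap.mulLeft ℂ (1 - C d * X) ∘ₗ (derivative ℂ : ℂ⟦X⟧ →ₗ[ℂ] ℂ⟦X⟧)
  refine Module.End.eigenvectors_linearIndependent' T (fun m : ℤ => (m : ℂ))
    Int.cast_injective _ fun m => ?_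
  refine ⟨Module.End.mem_eigenspace_iff.2 ?_, fun h => ?_⟩
  · rw [smul_eq_C_mul]
    exact flow_ode d m
  · simpa using congrArg constantCoeff h

/-- The series `(g - 1) / x`, where `g = flow d 1`. -/
def flowQuot (d : ℂ) : ℂ⟦X⟧ := PowerSeries.mk fun n => coeff (n + 1) (flow d 1)

lemma X_mul_flowQuot (d : ℂ) : X * flowQuot d = flow d 1 - 1 := by
  ext n
  cases n with
  | zero => simp
  | succ n => simp [coeff_succ_X_mul, flowQuot, coeff_one]

@[simp]
lemma constantCoeff_flowQuot (d : ℂ) : constantCoeff (flowQuot d) = 1 := by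
  rw [← coeff_zero_eq_constantCoeff_apply, flowQuot, coeff_mk, coeff_flow]
  simp

/-- The residue of `g' / (g - 1) ^ (n + 1)` for `g = flow d 1`. It is zero for `0 < n`, where the series
is a derivative. -/
lemma coeff_derivative_mul_inv_pow (d : ℂ) (n : ℕ) :
    coeff n (derivative ℂ (flow d 1) * (flowQuot d)⁻¹ ^ (n + 1)) = if n = 0 then 1 else 0 := by
  have hq : flowQuot d * (flowQuot d)⁻¹ = 1 := PowerSeries.mul_inv_cancel _ (by simp)
  have hg : derivative ℂ (flow d 1) = flowQuot d + X * derivative ℂ (flowQuot d) := by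
    have := congrArg (derivative ℂ) (X_mul_flowQuot d)
    rw [Derivation.leibniz, derivative_X, map_sub, smul_eq_mul, smul_eq_mul, derivative_one] at this
    linear_combination -this
  cases n with
  | zero => simp [hg]
  | succ n =>
    have h0 : derivative ℂ (flowQuot d) * (flowQuot d)⁻¹ ^ (n + 2)
        = -C ((n : ℂ) + 1)⁻¹ * derivative ℂ ((flowQuot d)⁻¹ ^ (n + 1)) := by
      rw [derivative_pow, derivative_inv']
      have : C ((n : ℂ) + 1)⁻¹ * ((n : ℂ⟦X⟧) + 1) = 1 := by
        have h' : (n : ℂ) + 1 ≠ 0 := by exact_mod_cast n.succ_ne_zero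
        rw [← map_natCast (C (R := ℂ)), ← map_one (C (R := ℂ)), ← map_add, ← map_mul,
          inv_mul_cancel₀ h']
      simp only [Nat.add_sub_cancel]
      push_cast
      linear_combination (-derivative ℂ (flowQuot d) * (flowQuot d)⁻¹ ^ (n + 2)) * this
    have h1 : derivative ℂ (flow d 1) * (flowQuot d)⁻¹ ^ (n + 1 + 1)
        = (flowQuot d)⁻¹ ^ (n + 1)
          + X * (-C ((n : ℂ) + 1)⁻¹ * derivative ℂ ((flowQuot d)⁻¹ ^ (n + 1))) := by
      rw [← h0, hg]
      linear_combination (flowQuot d)⁻¹ ^ (n + 1) * hq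
    rw [h1, map_add, coeff_succ_X_mul, neg_mul, map_neg, coeff_C_mul, coeff_derivative]
    have h' : (n : ℂ) + 1 ≠ 0 := by exact_mod_cast n.succ_ne_zero
    simp only [Nat.add_eq_zero_iff, one_ne_zero, and_false, if_false]
    field_simp
    ring

/-- The residue of `g ^ m g' / (g - 1) ^ (n + 1)` for `g = flow d 1` is that of
`y ^ m / (y - 1) ^ (n + 1)` at `y = 1`. Both sides satisfy Pascal's rule. -/
lemma coeff_flow_mul_derivative_mul_inv_pow (d : ℂ) (m : ℤ) (n : ℕ) :
    coeff n (flow d m * derivative ℂ (flow d 1) * (flowQuot d)⁻¹ ^ (n + 1))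
      = (Ring.choose m n : ℤ) := by
  have hq : flowQuot d * (flowQuot d)⁻¹ = 1 := PowerSeries.mul_inv_cancel _ (by simp)
  have hz (m : ℤ) : coeff 0 (flow d m * derivative ℂ (flow d 1) * (flowQuot d)⁻¹ ^ (0 + 1))
      = 1 := by
    have := coeff_derivative_mul_inv_pow d 0
    simp at this
    simp [this]
  have hs (m : ℤ) (n : ℕ) :
      coeff (n + 1) (flow d (m + 1 : ℤ) * derivative ℂ (flow d 1) * (flowQuot d)⁻¹ ^ (n + 1 + 1))
      = coeff (n + 1) (flow d m * derivative ℂ (flow d 1) * (flowQuot d)⁻¹ ^ (n + 1 + 1))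
        + coeff n (flow d m * derivative ℂ (flow d 1) * (flowQuot d)⁻¹ ^ (n + 1)) := by
    rw [← coeff_succ_X_mul n (flow d m * _ * _), ← map_add]
    congr 1
    push_cast
    rw [← flow_mul]
    linear_combination (-flow d m * derivative ℂ (flow d 1) * (flowQuot d)⁻¹ ^ (n + 2))
      * X_mul_flowQuot d + flow d m * derivative ℂ (flow d 1) * (flowQuot d)⁻¹ ^ (n + 1) * X * hq
  induction n generalizing m with
  | zero => rw [hz]; simp
  | succ n ih =>
    induction m with
    | zero =>
      have := coeff_derivative_mul_inv_pow d (n + 1)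
      simp at this
      simp [this, Ring.choose_zero_succ]
    | succ m hm =>
      rw [hs, hm, ih, Ring.choose_succ_succ]
      push_cast
      ring
    | pred m hm =>
      have h1 := hs (-(m : ℤ) - 1) n
      have h2 := Ring.choose_succ_succ (-(m : ℤ) - 1) n
      rw [sub_add_cancel] at h1 h2
      rw [hm, ih, h2] at h1
      push_cast at h1 ⊢
      linear_combination -h1

/-! ### The residue at `y = 1` from the expansions at `∞` and at `0` -/

/-- Multiplication by `y - 1` on two-sided formal series `∑ P_m y ^ m`. -/
def mulSubOne {M : Type*} [AddCommGroup M] (P : ℤ → M) : ℤ → M := fun m => P (m - 1) - P m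

/-- `∑_{m ≥ 0} binom(m, n) P_m + ∑_{m < 0} binom(m, n) Q_m`. If `P` and `Q` are the expansions at `∞`
and at `0` of a rational function of `y` with poles at `0`, `1` and `∞` only, this is the residue at
`y = 1` of its quotient by `(y - 1) ^ (n + 1)`. -/
def halfSum (P Q : ℤ → ℂ) (n : ℕ) : ℂ :=
  (∑ᶠ m : ℕ, (Ring.choose (m : ℤ) n : ℤ) * P m)
    + ∑ᶠ m : ℕ, (Ring.choose (-(m : ℤ) - 1) n : ℤ) * Q (-m - 1)

lemma finsum_eq_sum_range {M : Type*} [AddCommMonoid M] {f : ℕ → M} {B : ℕ}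
    (h : ∀ m, B ≤ m → f m = 0) : ∑ᶠ m, f m = ∑ m ∈ range B, f m := by
  refine finsum_eq_sum_of_support_subset _ fun m hm => ?_
  by_contra hc
  exact hm (h m (by simpa using hc))

lemma sum_range_choose_mulSubOne (P : ℤ → ℂ) (n B : ℕ) :
    ∑ m ∈ range B, (Ring.choose (m : ℤ) (n + 1) : ℤ) * mulSubOne P m
      = (∑ m ∈ range B, (Ring.choose (m : ℤ) n : ℤ) * P m)
        - (Ring.choose (B : ℤ) (n + 1) : ℤ) * P (B - 1) := by
  induction B with
  | zero => simp [Ring.choose_zero_succ]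
  | succ B ih =>
    rw [sum_range_succ, sum_range_succ, ih, mulSubOne]
    push_cast
    rw [Ring.choose_succ_succ, add_sub_cancel_right]
    push_cast
    ring

lemma sum_range_choose_neg_mulSubOne (Q : ℤ → ℂ) (n B : ℕ) :
    ∑ m ∈ range B, (Ring.choose (-(m : ℤ) - 1) (n + 1) : ℤ) * mulSubOne Q (-m - 1)
      = (∑ m ∈ range B, (Ring.choose (-(m : ℤ) - 1) n : ℤ) * Q (-m - 1))
        + (Ring.choose (-B : ℤ) (n + 1) : ℤ) * Q (-B - 1) := by
  induction B with
  | zero => simp [Ring.choose_zero_succ]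
  | succ B ih =>
    have h := Ring.choose_succ_succ (-(B : ℤ) - 1) n
    rw [sub_add_cancel] at h
    rw [sum_range_succ, sum_range_succ, ih, mulSubOne, h]
    push_cast
    rw [show (-((B : ℤ) + 1)) = -B - 1 by ring]
    ring

/-- Summation by parts; the boundary terms at `m = 0` vanish since `binom(0, n + 1) = 0`. -/
lemma halfSum_mulSubOne {P Q : ℤ → ℂ} {N N' : ℤ} (hP : ∀ m, N < m → P m = 0)
    (hQ : ∀ m, m < N' → Q m = 0) (n : ℕ) :
    halfSum (mulSubOne P) (mulSubOne Q) (n + 1) = halfSum P Q n := by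
  have hb : ∃ B : ℕ, N + 1 < B ∧ -(B : ℤ) < N' := ⟨N.natAbs + N'.natAbs + 2, by omega, by omega⟩
  obtain ⟨B, hB, hB'⟩ := hb
  rw [halfSum, halfSum, finsum_eq_sum_range (B := B), finsum_eq_sum_range (B := B),
    finsum_eq_sum_range (B := B), finsum_eq_sum_range (B := B), sum_range_choose_mulSubOne,
    sum_range_choose_neg_mulSubOne, hP _ (by omega), hQ _ (by omega)]
  · ring
  · intro m hm; rw [hQ _ (by omega), mul_zero]
  · intro m hm; rw [hP _ (by omega), mul_zero]
  · intro m hm; rw [mulSubOne, hQ _ (by omega), hQ _ (by omega), sub_zero, mul_zero]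
  · intro m hm; rw [mulSubOne, hP _ (by omega), hP _ (by omega), sub_zero, mul_zero]

lemma iterate_mulSubOne_eq_zero_of_lt {P : ℤ → ℂ} {N : ℤ} (hP : ∀ m, N < m → P m = 0) (k : ℕ) :
    ∀ m, N + k < m → mulSubOne^[k] P m = 0 := by
  induction k with
  | zero => simpa using hP
  | succ k ih =>
    intro m hm
    rw [Function.iterate_succ_apply', mulSubOne, ih _ (by omega), ih _ (by omega), sub_zero]

lemma iterate_mulSubOne_eq_zero_of_gt {Q : ℤ → ℂ} {N : ℤ} (hQ : ∀ m, m < N → Q m = 0) (k : ℕ) :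
    ∀ m, m < N → mulSubOne^[k] Q m = 0 := by
  induction k with
  | zero => simpa using hQ
  | succ k ih =>
    intro m hm
    rw [Function.iterate_succ_apply', mulSubOne, ih _ (by omega), ih _ (by omega), sub_zero]

lemma halfSum_iterate_mulSubOne {P Q : ℤ → ℂ} {N N' : ℤ} (hP : ∀ m, N < m → P m = 0)
    (hQ : ∀ m, m < N' → Q m = 0) (k : ℕ) :
    halfSum (mulSubOne^[k] P) (mulSubOne^[k] Q) k = halfSum P Q 0 := by
  induction k with
  | zero => rfl
  | succ k ih =>
    rw [Function.iterate_succ_apply', Function.iterate_succ_apply', ← ih]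
    exact halfSum_mulSubOne (iterate_mulSubOne_eq_zero_of_lt hP k)
      (iterate_mulSubOne_eq_zero_of_gt hQ k) k

lemma halfSum_self {f : ℤ → ℂ} (hf : f.support.Finite) (n : ℕ) :
    halfSum f f n = ∑ᶠ m : ℤ, (Ring.choose m n : ℤ) * f m := by
  have hF : (Function.support fun m : ℤ => (Ring.choose m n : ℤ) * f m).Finite :=
    hf.subset fun m hm h => hm (by simp only [h, mul_zero])
  rw [halfSum, ← finsum_mem_univ (fun m : ℤ => (Ring.choose m n : ℤ) * f m)]
  have h1 : (∑ᶠ m : ℕ, (Ring.choose (m : ℤ) n : ℤ) * f m)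
      = ∑ᶠ m ∈ Set.range (fun m : ℕ => (m : ℤ)), (Ring.choose m n : ℤ) * f m :=
    (finsum_mem_range (f := fun m : ℤ => (Ring.choose m n : ℤ) * f m) Nat.cast_injective).symm
  have h2 : (∑ᶠ m : ℕ, (Ring.choose (-(m : ℤ) - 1) n : ℤ) * f (-m - 1))
      = ∑ᶠ m ∈ Set.range (fun m : ℕ => -(m : ℤ) - 1), (Ring.choose m n : ℤ) * f m :=
    (finsum_mem_range (f := fun m : ℤ => (Ring.choose m n : ℤ) * f m)
      (g := fun m : ℕ => -(m : ℤ) - 1) (fun a b h => by simpa using h)).symm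
  have hu : Set.range (fun m : ℕ => (m : ℤ)) ∪ Set.range (fun m : ℕ => -(m : ℤ) - 1)
      = Set.univ := by
    refine Set.eq_univ_of_forall fun m => ?_
    rcases le_or_gt 0 m with h | h
    · exact Or.inl ⟨m.toNat, Int.toNat_of_nonneg h⟩
    · refine Or.inr ⟨(-m - 1).toNat, ?_⟩
      change -((-m - 1).toNat : ℤ) - 1 = m
      omega
  rw [h1, h2, ← hu, finsum_mem_union']
  · rw [Set.disjoint_left]
    rintro _ ⟨a, rfl⟩ ⟨b, hb⟩
    have hd : -(b : ℤ) - 1 = a := hb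
    omega
  · exact hF.subset Set.inter_subset_right
  · exact hF.subset Set.inter_subset_right

/-! ### Laurent polynomials at `y = g(x)` -/

/-- The Laurent polynomial `∑ f_m y ^ m` at `y = flow d 1`. The sum is meaningful for `f` of finite
support. -/
def flowEval (d : ℂ) (f : ℤ → ℂ) : ℂ⟦X⟧ := ∑ᶠ m : ℤ, f m • flow d m

lemma finite_support_smul_flow {f : ℤ → ℂ} (hf : f.support.Finite) (d : ℂ) :
    (Function.support fun m : ℤ => f m • flow d m).Finite :=
  hf.subset fun m hm h => hm (by simp only [h, zero_smul])

lemma finite_support_mulSubOne {f : ℤ → ℂ} (hf : f.support.Finite) :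
    (mulSubOne f).support.Finite := by
  refine ((hf.image (· + 1)).union hf).subset fun m hm => ?_
  by_contra h
  simp only [Set.mem_union, not_or] at h
  refine hm ?_
  have h1 : f m = 0 := by simpa using h.2
  have h2 : f (m - 1) = 0 := by
    by_contra h3
    exact h.1 ⟨m - 1, h3, by ring⟩
  rw [mulSubOne, h1, h2, sub_zero]

lemma finite_support_iterate_mulSubOne {f : ℤ → ℂ} (hf : f.support.Finite) (k : ℕ) :
    (mulSubOne^[k] f).support.Finite := by
  induction k with
  | zero => exact hf
  | succ k ih => rw [Function.iterate_succ_apply']; exact finite_support_mulSubOne ih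

lemma flowEval_mulSubOne {f : ℤ → ℂ} (hf : f.support.Finite) (d : ℂ) :
    flowEval d (mulSubOne f) = (flow d 1 - 1) * flowEval d f := by
  have h1 := finite_support_smul_flow hf d
  have h3 : (fun m : ℤ => f (m - 1) • flow d m) = fun m => flow d 1 *
      (f (m - 1) • flow d ((m - 1 : ℤ) : ℂ)) := by
    funext m
    rw [mul_smul_comm, flow_mul]
    congr 2
    push_cast
    ring
  have h2 : (Function.support fun m : ℤ => f (m - 1) • flow d m).Finite := by
    refine (h1.image (· + 1)).subset fun m hm => ⟨m - 1, fun h => hm ?_, by ring⟩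
    rw [h3]
    simp only at h ⊢
    rw [h, mul_zero]
  rw [sub_mul, one_mul, flowEval, flowEval]
  simp only [mulSubOne, sub_smul]
  rw [finsum_sub_distrib h2 h1, h3]
  congr 1
  rw [mul_finsum' _ _ h1]
  exact finsum_comp_equiv (Equiv.subRight (1 : ℤ))
    (f := fun m : ℤ => flow d 1 * (f m • flow d (m : ℂ)))

lemma flowEval_iterate_mulSubOne {f : ℤ → ℂ} (hf : f.support.Finite) (d : ℂ) (k : ℕ) :
    flowEval d (mulSubOne^[k] f) = (flow d 1 - 1) ^ k * flowEval d f := by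
  induction k with
  | zero => simp
  | succ k ih =>
    rw [Function.iterate_succ_apply', flowEval_mulSubOne (finite_support_iterate_mulSubOne hf k), ih,
      pow_succ']
    ring

lemma flowEval_injective {f f' : ℤ → ℂ} (hf : f.support.Finite) (hf' : f'.support.Finite) (d : ℂ)
    (h : flowEval d f = flowEval d f') : f = f' := by
  have h1 := finite_support_smul_flow hf d
  have h2 := finite_support_smul_flow hf' d
  have hs : (Function.support fun m => f m - f' m).Finite := by
    refine (hf.union hf').subset ?_
    exact Function.support_sub f f'
  have h3 : ∑ᶠ m : ℤ, (f m - f' m) • flow d m = 0 := by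
    simp only [sub_smul]
    rw [finsum_sub_distrib h1 h2]
    exact sub_eq_zero.2 h
  rw [finsum_eq_sum_of_support_subset (s := hs.toFinset)] at h3
  · have h4 := linearIndependent_iff'.1 (linearIndependent_flow d) _ _ h3
    funext m
    by_contra h5
    exact h5 (sub_eq_zero.1 (h4 m (by simpa [sub_eq_zero] using h5)))
  · intro m hm
    simp only [Set.Finite.coe_toFinset]
    intro h
    exact hm (by simp only [h, zero_smul])

/-! ### Relations between Laurent series: residues and the reversal -/

lemma exists_eq_single_mul (G : LaurentSeries ℂ) :
    ∃ (N : ℕ) (H : ℂ⟦X⟧), G = HahnSeries.single (-N : ℤ) 1 * HahnSeries.ofPowerSeries ℤ ℂ H := by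
  have h := LaurentSeries.single_order_mul_powerSeriesPart G
  have hb : ∃ N n : ℕ, G.order = -N + n := ⟨(-G.order).toNat, G.order.toNat, by omega⟩
  obtain ⟨N, n, hn⟩ := hb
  refine ⟨N, X ^ n * G.powerSeriesPart, ?_⟩
  rw [map_mul, map_pow, HahnSeries.ofPowerSeries_X, HahnSeries.single_pow, ← mul_assoc,
    HahnSeries.single_mul_single]
  conv_lhs => rw [← h, hn]
  simp

lemma coeff_single_mul_ofPowerSeries (N : ℤ) (H : ℂ⟦X⟧) (j : ℤ) :
    (HahnSeries.single N (1 : ℂ) * HahnSeries.ofPowerSeries ℤ ℂ H).coeff j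
      = if j < N then 0 else coeff (j - N).toNat H := by
  have h := HahnSeries.coeff_single_mul_add (r := (1 : ℂ)) (x := HahnSeries.ofPowerSeries ℤ ℂ H)
    (a := j - N) (b := N)
  rw [sub_add_cancel, one_mul] at h
  rw [h, PowerSeries.coeff_coe]
  rcases lt_or_ge j N with hj | hj
  · rw [if_pos (by omega), if_pos hj]
  · rw [if_neg (by omega), if_neg (by omega), show (j - N).natAbs = (j - N).toNat by omega]

lemma coeff_ofPowerSeries_mul (p : ℂ⟦X⟧) (G : LaurentSeries ℂ) (j : ℤ) :
    (HahnSeries.ofPowerSeries ℤ ℂ p * G).coeff j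
      = ∑ᶠ i : ℕ, coeff i p * G.coeff (j - i) := by
  obtain ⟨N, H, rfl⟩ := exists_eq_single_mul G
  rw [mul_left_comm, ← map_mul, coeff_single_mul_ofPowerSeries]
  split_ifs with h
  · symm
    refine finsum_eq_zero_of_forall_eq_zero fun i => ?_
    rw [coeff_single_mul_ofPowerSeries, if_pos (by omega), mul_zero]
  · obtain ⟨n, rfl⟩ : ∃ n : ℕ, j = -N + n := ⟨(j + N).toNat, by omega⟩
    rw [finsum_eq_sum_range (B := n + 1)]
    · rw [coeff_mul, Nat.sum_antidiagonal_eq_sum_range_succ fun i j => coeff i p * coeff j H]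
      have e : (-(N : ℤ) + n - -N).toNat = n := by omega
      rw [e]
      refine sum_congr rfl fun i hi => ?_
      have := mem_range.1 hi
      have e : (-(N : ℤ) + n - i - -N).toNat = n - i := by omega
      rw [coeff_single_mul_ofPowerSeries, if_neg (by omega), e]
    · intro m hm
      rw [coeff_single_mul_ofPowerSeries, if_pos (by omega), mul_zero]

/-- If `(g - 1) ^ k G = f(g)`, the residue of `g' / (g - 1) * G` is the residue of
`f(y) / (y - 1) ^ (k + 1)` at `y = 1`. -/
lemma coeff_zero_eq_finsum_choose {d : ℂ} {G : LaurentSeries ℂ} {k : ℕ} {f : ℤ → ℂ}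
    (hf : f.support.Finite)
    (h : HahnSeries.ofPowerSeries ℤ ℂ ((flow d 1 - 1) ^ k) * G
      = HahnSeries.ofPowerSeries ℤ ℂ (flowEval d f)) :
    (HahnSeries.ofPowerSeries ℤ ℂ (derivative ℂ (flow d 1) * (flowQuot d)⁻¹) * G).coeff 0
      = ∑ᶠ m : ℤ, (Ring.choose m k : ℤ) * f m := by
  have hq : flowQuot d * (flowQuot d)⁻¹ = 1 := PowerSeries.mul_inv_cancel _ (by simp)
  have hq' : HahnSeries.ofPowerSeries ℤ ℂ (flowQuot d ^ k)
      * HahnSeries.ofPowerSeries ℤ ℂ ((flowQuot d)⁻¹ ^ k) = 1 := by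
    rw [← map_mul, ← mul_pow, hq, one_pow, map_one]
  have hX : HahnSeries.single (-k : ℤ) (1 : ℂ) * HahnSeries.ofPowerSeries ℤ ℂ (X ^ k) = 1 := by
    simp [HahnSeries.single_pow]
  have hG : HahnSeries.ofPowerSeries ℤ ℂ (derivative ℂ (flow d 1) * (flowQuot d)⁻¹) * G
      = HahnSeries.single (-k : ℤ) 1 * HahnSeries.ofPowerSeries ℤ ℂ
        (derivative ℂ (flow d 1) * (flowQuot d)⁻¹ ^ (k + 1) * flowEval d f) := by
    rw [← X_mul_flowQuot, mul_pow, map_mul] at h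
    rw [pow_succ, map_mul _ _ (flowEval d f), ← h]
    simp only [map_mul]
    linear_combination (-HahnSeries.ofPowerSeries ℤ ℂ (derivative ℂ (flow d 1))
      * HahnSeries.ofPowerSeries ℤ ℂ (flowQuot d)⁻¹ * G) *
      (hX * HahnSeries.ofPowerSeries ℤ ℂ (flowQuot d ^ k)
      * HahnSeries.ofPowerSeries ℤ ℂ ((flowQuot d)⁻¹ ^ k) + hq')
  rw [hG, coeff_single_mul_ofPowerSeries, if_neg (by omega), flowEval]
  have hk : (0 - (-k : ℤ)).toNat = k := by omega
  rw [hk, mul_finsum' _ _ (finite_support_smul_flow hf d)]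
  have hs := finite_support_smul_flow hf d
  have hs' : (Function.support fun m : ℤ => derivative ℂ (flow d 1) * (flowQuot d)⁻¹ ^ (k + 1) *
      (f m • flow d m)).Finite := hs.subset fun m hm h => hm (by simp only [h, mul_zero])
  have hmap := (coeff k : ℂ⟦X⟧ →ₗ[ℂ] ℂ).toAddMonoidHom.map_finsum hs'
  simp only [LinearMap.toAddMonoidHom_coe] at hmap
  rw [hmap]
  refine finsum_congr fun m => ?_
  rw [mul_smul_comm, map_smul, ← coeff_flow_mul_derivative_mul_inv_pow d m k, smul_eq_mul, mul_comm]
  congr 2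
  ring

lemma subst_X_mul_add_C (d c : ℂ) (H : ℂ⟦X⟧) :
    (X * H + C c).subst (reversal d) = reversal d * H.subst (reversal d) + C c := by
  have hs := hasSubst_reversal d
  rw [subst_add hs, subst_mul hs, subst_X hs, subst_C]
  rfl

lemma coeff_flow_mul_subst (d a : ℂ) (H : ℂ⟦X⟧) (n : ℕ) :
    coeff n (flow d a * H.subst (reversal d))
      = ∑ l ∈ range (n + 1), (-1) ^ l * coeff (n - l) (flow d (a + l * d)) * coeff l H := by
  induction n generalizing a H with
  | zero =>
    obtain ⟨H', c, rfl⟩ : ∃ (H' : ℂ⟦X⟧) (c : ℂ), H = X * H' + C c :=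
      ⟨_, _, eq_X_mul_shift_add_const H⟩
    rw [subst_X_mul_add_C]
    simp [reversal]
  | succ n ih =>
    obtain ⟨H', c, rfl⟩ : ∃ (H' : ℂ⟦X⟧) (c : ℂ), H = X * H' + C c :=
      ⟨_, _, eq_X_mul_shift_add_const H⟩
    have h : flow d a * (X * H' + C c).subst (reversal d)
        = C c * flow d a - X * (flow d (a + d) * H'.subst (reversal d)) := by
      rw [subst_X_mul_add_C, reversal, ← flow_mul]
      ring
    rw [h, map_sub, coeff_C_mul, coeff_succ_X_mul, ih, sum_range_succ' _ (n + 1), sub_eq_add_neg, add_comm,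
      ← sum_neg_distrib]
    congr 1
    · refine sum_congr rfl fun l _ => ?_
      rw [map_add, coeff_succ_X_mul, coeff_C, if_neg (by omega), Nat.add_sub_add_right,
        show a + d + l * d = a + (l + 1 : ℕ) * d by push_cast; ring]
      ring
    · simp [mul_comm]

lemma flow_mul_flowEval (d : ℂ) (s : ℤ) {f : ℤ → ℂ} (hf : f.support.Finite) :
    flow d s * flowEval d f = flowEval d fun m => f (m - s) := by
  rw [flowEval, mul_finsum' _ _ (finite_support_smul_flow hf d), flowEval,
    ← finsum_comp_equiv (Equiv.subRight s)]
  refine finsum_congr fun m => ?_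
  rw [mul_smul_comm, flow_mul]
  simp

lemma subst_flowEval (d : ℂ) {f : ℤ → ℂ} (hf : f.support.Finite) :
    (flowEval d f).subst (reversal d) = flowEval d fun m => f (-m) := by
  have hs := hasSubst_reversal d
  have h := (substAlgHom hs : ℂ⟦X⟧ →ₐ[ℂ] ℂ⟦X⟧).toLinearMap.toAddMonoidHom.map_finsum
    (finite_support_smul_flow hf d)
  simp only [LinearMap.toAddMonoidHom_coe, AlgHom.toLinearMap_apply, coe_substAlgHom] at h
  rw [flowEval, h, flowEval, ← finsum_comp_equiv (Equiv.neg ℤ)]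
  refine finsum_congr fun m => ?_
  rw [subst_smul hs, subst_flow]
  simp

/-- The substitution `reversal d`, applied to a relation `(g - 1) ^ k G' = f(g)`. The hypothesis on
`G` says that `G = g ^ t G'(reversal d)`; as `g` becomes `g⁻¹`, the relation for `G` has
the Laurent polynomial `y ^ t f(y⁻¹)`, up to the factor `(-y) ^ k`. -/
lemma reversed_relation {d : ℂ} {t : ℤ} {G G' : LaurentSeries ℂ} {k : ℕ} {f : ℤ → ℂ}
    (hf : f.support.Finite)
    (hG : ∀ j : ℤ, G.coeff j = ∑ᶠ i : ℕ, (Int.negOnePow (j - i) : ℤ)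
      * coeff i (flow d (t + (j - i : ℤ) * d)) * G'.coeff (j - i))
    (h : HahnSeries.ofPowerSeries ℤ ℂ ((flow d 1 - 1) ^ k) * G'
      = HahnSeries.ofPowerSeries ℤ ℂ (flowEval d f)) :
    HahnSeries.ofPowerSeries ℤ ℂ ((flow d 1 - 1) ^ k) * G
      = HahnSeries.ofPowerSeries ℤ ℂ (flowEval d fun m => (-1) ^ k * f (t + k - m)) := by
  have hs := hasSubst_reversal d
  obtain ⟨N, H, rfl⟩ := exists_eq_single_mul G'
  have hX : HahnSeries.single (-N : ℤ) (1 : ℂ) * HahnSeries.ofPowerSeries ℤ ℂ (X ^ N) = 1 := by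
    simp [HahnSeries.single_pow]
  have hGe : G = HahnSeries.single (-N : ℤ) 1 * HahnSeries.ofPowerSeries ℤ ℂ
      ((-1) ^ N * (flow d (t - N * d) * H.subst (reversal d))) := by
    ext j
    rw [hG, coeff_single_mul_ofPowerSeries]
    split_ifs with hj
    · refine finsum_eq_zero_of_forall_eq_zero fun i => ?_
      rw [coeff_single_mul_ofPowerSeries, if_pos (by omega), mul_zero]
    · obtain ⟨n, rfl⟩ : ∃ n : ℕ, j = -N + n := ⟨(j + N).toNat, by omega⟩
      have hn : (-(N : ℤ) + n - -N).toNat = n := by omega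
      have hC : ((-1 : ℂ⟦X⟧)) ^ N = C ((-1) ^ N) := by simp
      rw [hn, hC, coeff_C_mul, coeff_flow_mul_subst, finsum_eq_sum_range (B := n + 1),
        ← sum_range_reflect, mul_sum]
      · refine sum_congr rfl fun l hl => ?_
        have := mem_range.1 hl
        obtain ⟨i, rfl⟩ : ∃ i : ℕ, n = l + i := ⟨n - l, by omega⟩
        have e1 : l + i + 1 - 1 - l = i := by omega
        have e2 : l + i - l = i := by omega
        have e3 : (-(N : ℤ) + (l + i : ℕ) - i) = l - N := by push_cast; ring
        have e4 : ((l : ℤ) - N - -N).toNat = l := by omega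
        have e5 : (Int.negOnePow ((l : ℤ) - N) : ℤ) = (-1) ^ N * (-1) ^ l := by
          rw [Int.negOnePow_sub]
          simp [Int.negOnePow, mul_comm]
        rw [e1, e2, e3, coeff_single_mul_ofPowerSeries, if_neg (by omega), e4, e5]
        push_cast
        rw [show (t : ℂ) + (l - N) * d = t - N * d + l * d by ring]
        ring
      · intro m hm
        rw [coeff_single_mul_ofPowerSeries, if_pos (by omega), mul_zero]
  have hH : (flow d 1 - 1) ^ k * H = X ^ N * flowEval d f := by
    apply HahnSeries.ofPowerSeries_injective (Γ := ℤ) (R := ℂ)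
    rw [map_mul _ (X ^ N), ← h, map_mul]
    linear_combination (-HahnSeries.ofPowerSeries ℤ ℂ ((flow d 1 - 1) ^ k)
      * HahnSeries.ofPowerSeries ℤ ℂ H) * hX
  have h1 : (1 : ℂ⟦X⟧).subst (reversal d) = 1 := by
    rw [← coe_substAlgHom hs, map_one]
  have hsub := congrArg (subst (reversal d)) hH
  rw [subst_mul hs, subst_mul hs, subst_pow hs, subst_pow hs, subst_sub hs, subst_flow, h1,
    subst_X hs, subst_flowEval d hf] at hsub
  have hk : (flow d 1 - 1) ^ k = (-1) ^ k * flow d k * (flow d (-1) - 1) ^ k := by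
    have h2 : flow d k = flow d 1 ^ k := by rw [flow_pow, mul_one]
    have h3 : flow d 1 * flow d (-1) = 1 := by rw [flow_mul, add_neg_cancel, flow_zero]
    rw [h2, ← mul_pow, ← mul_pow]
    congr 1
    linear_combination h3
  have hev : flowEval d (fun m => (-1) ^ k * f (t + k - m))
      = (-1) ^ k * (flow d (t + k) * flowEval d fun m => f (-m)) := by
    have h2 : (Function.support fun m => f (-m)).Finite :=
      hf.preimage (neg_injective.injOn (s := _))
    have h3 := flow_mul_flowEval d (t + k) h2
    push_cast at h3
    have hC : ((-1 : ℂ⟦X⟧)) ^ k = C ((-1) ^ k) := by simp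
    rw [h3, flowEval, flowEval, hC, ← smul_eq_C_mul, smul_finsum]
    refine finsum_congr fun m => ?_
    rw [smul_smul, neg_sub]
  have hfl : flow d (t + k) = flow d k * flow d (t - N * d) * flow d (N * d) := by
    rw [flow_mul, flow_mul]
    congr 1
    ring
  have hrev : reversal d ^ N = (-1) ^ N * X ^ N * flow d (N * d) := by
    rw [reversal, neg_pow, mul_pow, flow_pow, mul_assoc]
  have hsq : ((-1 : ℂ⟦X⟧) ^ N) * (-1) ^ N = 1 := by rw [← mul_pow]; simp
  have hfin : (flow d 1 - 1) ^ k * ((-1) ^ N * (flow d (t - N * d) * H.subst (reversal d)))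
      = X ^ N * flowEval d fun m => (-1) ^ k * f (t + k - m) := by
    rw [hrev] at hsub
    rw [hev, hk, hfl]
    linear_combination ((-1) ^ k * flow d k * (-1) ^ N * flow d (t - N * d)) * hsub
      + ((-1) ^ k * flow d k * flow d (t - N * d) * X ^ N * flow d (N * d)
        * flowEval d fun m => f (-m)) * hsq
  rw [hGe, mul_left_comm, ← map_mul, hfin, map_mul, ← mul_assoc, hX, one_mul]

/-! ### The numbers `h_n` -/

lemma coeff_flow_eps (ε : ℤ) (n : ℕ) :
    coeff n (flow ((ε : ℂ) - 1) ε) = 1 / (n.factorial : ℂ) * epsFac ε n := by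
  rw [coeff_flow, epsFac, one_div, div_eq_mul_inv, mul_comm]

lemma derivative_flow_eps (ε : ℤ) :
    derivative ℂ (flow ((ε : ℂ) - 1) 1) = flow ((ε : ℂ) - 1) ε := by
  rw [derivative_flow_one, add_sub_cancel]

lemma coeff_flow_one_succ (ε : ℤ) (n : ℕ) :
    coeff (n + 1) (flow ((ε : ℂ) - 1) 1) = epsFac ε n / ((n + 1).factorial : ℂ) := by
  rw [coeff_flow, epsFac, prod_range_succ']
  simp only [Nat.cast_zero, zero_mul, add_zero, mul_one]
  congr 1
  refine prod_congr rfl fun s _ => ?_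
  push_cast
  ring

/-- The terms of `flowQuot (ε - 1)` in the degrees `1, …, n`. -/
def quotTail (ε : ℤ) (n : ℕ) : ℂ⟦X⟧ :=
  ∑ m : Fin n, C (epsFac ε ((m : ℕ) + 1) / (((m : ℕ) + 2).factorial : ℂ)) * X ^ ((m : ℕ) + 1)

lemma X_dvd_quotTail (ε : ℤ) (n : ℕ) : X ∣ quotTail ε n :=
  dvd_sum fun _ _ => Dvd.dvd.mul_left (dvd_pow_self X (Nat.succ_ne_zero _)) _

lemma X_pow_dvd_flowQuot_sub (ε : ℤ) (n : ℕ) :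
    X ^ (n + 1) ∣ flowQuot ((ε : ℂ) - 1) - (1 + quotTail ε n) := by
  rw [X_pow_dvd_iff]
  intro j hj
  rw [map_sub, map_add, flowQuot, coeff_mk, coeff_flow_one_succ, quotTail, map_sum, coeff_one]
  simp only [coeff_C_mul, coeff_X_pow]
  cases j with
  | zero => simp [epsFac]
  | succ j =>
    rw [sum_eq_single ⟨j, by omega⟩]
    · simp
    · intro m _ hm
      rw [if_neg, mul_zero]
      intro h
      exact hm (Fin.ext (by simpa using h.symm))
    · simp

lemma coeff_neg_quotTail_pow (ε : ℤ) (n k : ℕ) :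
    coeff n ((-quotTail ε n) ^ k)
      = ∑ r ∈ (piAntidiag univ k) with ∑ m : Fin n, ((m : ℕ) + 1) * r m = n,
        (-1 : ℂ) ^ (∑ m, r m) * ((∑ m, r m).factorial : ℂ) *
          ∏ m : Fin n, (1 / ((r m).factorial : ℂ)) *
            (epsFac ε ((m : ℕ) + 1) / (((m : ℕ) + 2).factorial : ℂ)) ^ (r m) := by
  have hC : ((-1 : ℂ⟦X⟧)) ^ k = C ((-1) ^ k) := by simp
  rw [neg_pow, hC, coeff_C_mul, quotTail, sum_pow_eq_sum_piAntidiag, map_sum, mul_sum, sum_filter]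
  refine sum_congr rfl fun r hr => ?_
  have hk : ∑ m, r m = k := by simpa using hr
  simp only [mul_pow, ← map_pow, ← pow_mul]
  rw [prod_mul_distrib, ← map_prod, prod_pow_eq_pow_sum, ← map_natCast (C (R := ℂ)), coeff_C_mul,
    coeff_C_mul, coeff_X_pow]
  simp only [eq_comm (a := n)]
  split_ifs with h
  · have hs := Nat.multinomial_spec univ r
    have hne : (∏ m, ((r m).factorial : ℂ)) ≠ 0 :=
      prod_ne_zero_iff.2 fun m _ => by exact_mod_cast (r m).factorial_ne_zero
    rw [← hs, hk, prod_mul_distrib, prod_div_distrib]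
    push_cast
    simp only [prod_const_one]
    field_simp
  · simp

/-- By the multinomial theorem, the sum defining `h_n`, sorted by `∑ r_m`, is a geometric sum. -/
lemma coeff_geom_sum_quotTail (ε : ℤ) (n : ℕ) :
    coeff n (∑ k ∈ range (n + 1), (-quotTail ε n) ^ k) = hCoeff ε n := by
  rw [map_sum, hCoeff]
  have hle (r : Fin n → ℕ) (h : ∑ m : Fin n, ((m : ℕ) + 1) * r m = n) : ∑ m, r m ≤ n := by
    conv_rhs => rw [← h]
    exact sum_le_sum fun m _ => Nat.le_mul_of_pos_left _ (Nat.succ_pos _)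
  rw [← sum_fiberwise_of_maps_to (t := range (n + 1)) (g := fun r : Fin n → ℕ => ∑ m, r m)]
  · refine sum_congr rfl fun k hk => ?_
    rw [coeff_neg_quotTail_pow]
    refine sum_congr ?_ fun _ _ => rfl
    ext r
    simp only [mem_filter, mem_piAntidiag, Fintype.mem_piFinset, mem_range, mem_univ, implies_true,
      and_true]
    refine ⟨fun ⟨h1, h2⟩ => ⟨⟨fun m => ?_, h2⟩, h1⟩, fun ⟨⟨_, h2⟩, h1⟩ => ⟨h1, h2⟩⟩
    have := single_le_sum (f := r) (fun _ _ => Nat.zero_le _) (mem_univ m)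
    have := hle r h2
    omega
  · intro r hr
    rw [mem_range]
    have := hle r (mem_filter.1 hr).2
    omega

/-- The `h_n` are the coefficients of `x / (g - 1)`. -/
lemma coeff_inv_flowQuot (ε : ℤ) (n : ℕ) :
    coeff n (flowQuot ((ε : ℂ) - 1))⁻¹ = hCoeff ε n := by
  have hq : flowQuot ((ε : ℂ) - 1) * (flowQuot ((ε : ℂ) - 1))⁻¹ = 1 :=
    PowerSeries.mul_inv_cancel _ (by simp)
  have h1 := (pow_dvd_pow_of_dvd (X_dvd_quotTail ε n) (n + 1))
  have h2 := X_pow_dvd_flowQuot_sub ε n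
  have h3 := mul_neg_geom_sum (-quotTail ε n) (n + 1)
  obtain ⟨a, ha⟩ := h1
  obtain ⟨b, hb⟩ := h2
  set S := ∑ k ∈ range (n + 1), (-quotTail ε n) ^ k
  rw [neg_pow, ha] at h3
  have hS : X ^ (n + 1) ∣ (flowQuot ((ε : ℂ) - 1))⁻¹ - S :=
    ⟨(flowQuot ((ε : ℂ) - 1))⁻¹ * ((-1) ^ (n + 1) * a - b * S), by
      linear_combination (flowQuot ((ε : ℂ) - 1))⁻¹ * (-h3 - hb * S) + S * hq⟩
  have h := X_pow_dvd_iff.1 hS n (Nat.lt_succ_self n)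
  rw [map_sub, coeff_geom_sum_quotTail] at h
  exact sub_eq_zero.1 h

/-- The coefficients in the formula are those of `x g' / (g - 1)`. -/
lemma coeff_derivative_flow_mul_inv (ε : ℤ) (n : ℕ) :
    coeff n (derivative ℂ (flow ((ε : ℂ) - 1) 1) * (flowQuot ((ε : ℂ) - 1))⁻¹)
      = ∑ i ∈ range (n + 1), 1 / (i.factorial : ℂ) * epsFac ε i * hCoeff ε (n - i) := by
  rw [derivative_flow_eps, coeff_mul, Nat.sum_antidiagonal_eq_sum_range_succ fun i j =>
    coeff i (flow ((ε : ℂ) - 1) ε) * coeff j (flowQuot ((ε : ℂ) - 1))⁻¹]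
  refine sum_congr rfl fun i _ => ?_
  rw [coeff_flow_eps, coeff_inv_flowQuot]

/-! ### The powers of `φ_ε` in `ℂ((z₂))((z₀))` -/

/-- The substitution `x ↦ z₀ z₂ ^ (ε - 1)` as a ring homomorphism from `ℂ[[x]]`. -/
def phiHom (ε : ℤ) : ℂ⟦X⟧ →+* LaurentSeries (LaurentSeries ℂ) :=
  (HahnSeries.ofPowerSeries ℤ (LaurentSeries ℂ)).comp
    ((PowerSeries.rescale (HahnSeries.single (ε - 1) 1)).comp (PowerSeries.map HahnSeries.C))

lemma coeff_phiHom (ε : ℤ) (p : ℂ⟦X⟧) (j : ℤ) :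
    (phiHom ε p).coeff j
      = if j < 0 then 0 else HahnSeries.single (j * (ε - 1)) (coeff j.toNat p) := by
  simp only [phiHom, RingHom.comp_apply]
  rw [PowerSeries.coeff_coe]
  split_ifs with h
  · rfl
  · obtain ⟨n, rfl⟩ : ∃ n : ℕ, j = n := ⟨j.toNat, by omega⟩
    rw [coeff_rescale, coeff_map, HahnSeries.single_pow, HahnSeries.C_apply,
      HahnSeries.single_mul_single]
    simp

lemma epsDeriv_single (ε a : ℤ) (c : ℂ) :
    epsDeriv ε (HahnSeries.single a c) = HahnSeries.single (a + (ε - 1)) (a * c) := by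
  rw [epsDeriv, LaurentSeries.derivative_apply, LaurentSeries.hasseDeriv_single,
    HahnSeries.single_mul_single]
  rw [show ε + (a - (1 : ℕ)) = a + (ε - 1) by push_cast; ring]
  simp

lemma iterate_epsDeriv_single (ε : ℤ) (j : ℕ) :
    (epsDeriv ε)^[j] (HahnSeries.single 1 1)
      = HahnSeries.single (1 + j * (ε - 1)) (∏ s ∈ range j, (1 + s * ((ε : ℂ) - 1))) := by
  induction j with
  | zero => simp
  | succ j ih =>
    rw [Function.iterate_succ_apply', ih, epsDeriv_single, prod_range_succ,
      show (1 + j * (ε - 1) + (ε - 1) : ℤ) = 1 + (j + 1 : ℕ) * (ε - 1) by push_cast; ring,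
      mul_comm (∏ s ∈ range j, (1 + s * ((ε : ℂ) - 1)))]
    push_cast
    rfl

lemma phi_eq (ε : ℤ) : phi ε = z₂ * phiHom ε (flow ((ε : ℂ) - 1) 1) := by
  refine HahnSeries.ext (funext fun j => ?_)
  rw [z₂, HahnSeries.C_mul_eq_smul, HahnSeries.coeff_smul, coeff_phiHom, phi, PowerSeries.coeff_coe]
  split_ifs with h
  · simp
  · obtain ⟨n, rfl⟩ : ∃ n : ℕ, j = n := ⟨j.toNat, by omega⟩
    rw [coeff_mk, smul_eq_mul, HahnSeries.single_mul_single, Int.toNat_natCast, Int.natAbs_natCast,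
      iterate_epsDeriv_single, coeff_flow]
    ext r
    rw [HahnSeries.coeff_smul, HahnSeries.coeff_single, HahnSeries.coeff_single, smul_eq_mul, one_mul,
      div_eq_mul_inv, mul_ite, mul_zero, mul_comm ((n.factorial : ℂ)⁻¹)]

lemma zpow_map_single {K : Type*} [Field K] (f : LaurentSeries ℂ →+* K) (m : ℤ) :
    f (HahnSeries.single 1 1) ^ m = f (HahnSeries.single m 1) := by
  rw [← map_zpow₀, ← RatFunc.single_zpow]

lemma map_flow_zpow {K : Type*} [Field K] (f : ℂ⟦X⟧ →+* K) (d : ℂ) (m : ℤ) :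
    f (flow d 1) ^ m = f (flow d m) := by
  have h (n : ℕ) : f (flow d 1) ^ n = f (flow d n) := by
    rw [← map_pow, flow_pow, mul_one]
  obtain ⟨n, rfl | rfl⟩ := m.eq_nat_or_neg
  · rw [zpow_natCast, h, Int.cast_natCast]
  · rw [zpow_neg, zpow_natCast, h]
    symm
    refine eq_inv_of_mul_eq_one_left ?_
    rw [← map_mul, flow_mul]
    simp

lemma phi_zpow (ε m : ℤ) :
    phi ε ^ m = HahnSeries.C (HahnSeries.single m 1) * phiHom ε (flow ((ε : ℂ) - 1) m) := by
  rw [phi_eq]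
  refine (mul_zpow z₂ _ m).trans ?_
  exact congrArg₂ _ (zpow_map_single (K := LaurentSeries (LaurentSeries ℂ)) HahnSeries.C m) (map_flow_zpow (K := LaurentSeries (LaurentSeries ℂ)) (phiHom ε) _ m)

lemma phi_sub_pow (ε : ℤ) (k : ℕ) :
    (phi ε - z₂) ^ k = HahnSeries.C (HahnSeries.single (k : ℤ) 1)
      * phiHom ε ((flow ((ε : ℂ) - 1) 1 - 1) ^ k) := by
  have h : phi ε - z₂ = z₂ * phiHom ε (flow ((ε : ℂ) - 1) 1 - 1) := by
    rw [phi_eq, map_sub, map_one]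
    ring
  rw [h]
  refine (mul_pow z₂ _ k).trans (congrArg₂ _ ?_ (map_pow (phiHom ε) _ k).symm)
  exact (zpow_natCast _ k).symm.trans (zpow_map_single (K := LaurentSeries (LaurentSeries ℂ)) HahnSeries.C k)

lemma coeff_coeff_C_single_mul_phiHom (ε m : ℤ) (p : ℂ⟦X⟧) (j r : ℤ) :
    ((HahnSeries.C (HahnSeries.single m (1 : ℂ)) * phiHom ε p).coeff j).coeff r
      = if 0 ≤ j ∧ r = m + j * (ε - 1) then coeff j.toNat p else 0 := by
  rw [HahnSeries.C_mul_eq_smul, HahnSeries.coeff_smul, coeff_phiHom]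
  by_cases h : j < 0
  · rw [if_pos h, if_neg (by omega)]
    simp
  · rw [if_neg h, smul_eq_mul, HahnSeries.single_mul_single, HahnSeries.coeff_single, one_mul]
    congr 1
    simp only [eq_iff_iff]
    exact ⟨fun h1 => ⟨by omega, h1⟩, fun h1 => h1.2⟩

lemma coeff_coeff_phi_zpow (ε m j r : ℤ) :
    ((phi ε ^ m).coeff j).coeff r
      = if 0 ≤ j ∧ r = m + j * (ε - 1) then coeff j.toNat (flow ((ε : ℂ) - 1) m) else 0 := by
  rw [phi_zpow, coeff_coeff_C_single_mul_phiHom]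

lemma coeff_coeff_phi_sub_pow (ε : ℤ) (k : ℕ) (j r : ℤ) :
    (((phi ε - z₂) ^ k).coeff j).coeff r
      = if 0 ≤ j ∧ r = k + j * (ε - 1) then coeff j.toNat ((flow ((ε : ℂ) - 1) 1 - 1) ^ k)
        else 0 := by
  rw [phi_sub_pow, coeff_coeff_C_single_mul_phiHom]

lemma finsum_eq_finsum_comp {α β M : Type*} [AddCommMonoid M] {g : β → α}
    (hg : Function.Injective g) {f : α → M} (hf : ∀ a, a ∉ Set.range g → f a = 0) :
    ∑ᶠ a, f a = ∑ᶠ b, f (g b) := by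
  rw [← finsum_mem_range hg]
  refine finsum_congr fun a => ?_
  by_cases h : a ∈ Set.range g
  · simp only [h, finsum_true]
  · simp only [h, finsum_false, hf a h]

section Series

variable {W : Type*} [AddCommGroup W] [Module ℂ W]

lemma substPhi_natCast (ε : ℤ) (F : ℤ → ℤ → W) (j : ℕ) (t : ℤ) :
    substPhi ε F j (t + j * (ε - 1))
      = ∑ᶠ m : ℤ, coeff j (flow ((ε : ℂ) - 1) m) • F m (t - m) := by
  rw [substPhi, finsum_eq_finsum_comp (g := fun m : ℤ => (m, t - m)) fun a b h => congrArg Prod.fst h]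
  · refine finsum_congr fun m => ?_
    rw [coeff_coeff_phi_zpow, if_pos ⟨by omega, by ring⟩, Int.toNat_natCast]
  · rintro ⟨m, n⟩ h
    rw [coeff_coeff_phi_zpow, if_neg, zero_smul]
    rintro ⟨-, h2⟩
    refine h ⟨m, Prod.ext rfl ?_⟩
    simp only at h2 ⊢
    linear_combination h2

lemma substPhi_of_neg (ε : ℤ) (F : ℤ → ℤ → W) {j : ℤ} (hj : j < 0) (p : ℤ) :
    substPhi ε F j p = 0 := by
  refine finsum_eq_zero_of_forall_eq_zero fun q => ?_
  rw [coeff_coeff_phi_zpow, if_neg (by omega), zero_smul]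

lemma scalarMul_phi_sub_pow (ε : ℤ) (k : ℕ) (G : ℤ → ℤ → W) (j t : ℤ) :
    scalarMul ((phi ε - z₂) ^ k) G j (t + k + j * (ε - 1))
      = ∑ᶠ i : ℕ, coeff i ((flow ((ε : ℂ) - 1) 1 - 1) ^ k) • G (j - i) (t + (j - i) * (ε - 1)) := by
  rw [scalarMul, finsum_eq_finsum_comp (g := fun i : ℕ => ((i : ℤ), (k : ℤ) + i * (ε - 1)))
    fun a b h => by simpa using congrArg Prod.fst h]
  · refine finsum_congr fun i => ?_
    rw [coeff_coeff_phi_sub_pow, if_pos ⟨by simp, rfl⟩, Int.toNat_natCast]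
    congr 2
    ring
  · rintro ⟨i, r⟩ h
    rw [coeff_coeff_phi_sub_pow, if_neg, zero_smul]
    rintro ⟨h1, h2⟩
    simp only at h1 h2
    refine h ⟨i.toNat, ?_⟩
    simp only [Int.toNat_of_nonneg h1, h2]

lemma iterate_mulSub (F : ℤ → ℤ → W) (l : W →ₗ[ℂ] ℂ) (k : ℕ) (t m : ℤ) :
    l (mulSub^[k] F m (t + k - m)) = mulSubOne^[k] (fun m => l (F m (t - m))) m := by
  induction k generalizing m with
  | zero => simp
  | succ k ih =>
    rw [Function.iterate_succ_apply', Function.iterate_succ_apply', mulSubOne, mulSub, map_sub,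
      ← ih, ← ih, show t + (k + 1 : ℕ) - m = t + k - (m - 1) by push_cast; ring,
      show t + k - (m - 1) - 1 = t + k - m by ring]

end Series

/-! ### The one-variable form of the module axioms -/

variable {ε : ℤ} {V : Type*} [AddCommGroup V] [Module ℂ V] {𝒱 : VertexAlgebra V}
  {W : Type*} [AddCommGroup W] [Module ℂ W]

/-- The part of `l (Y_W(Y(u, z₀) v, z₂) w)` in the monomials `z₀ ^ j z₂ ^ (t + j (ε - 1))`, divided by
`z₂ ^ t` and written as a Laurent series in `x = z₀ z₂ ^ (ε - 1)`. -/
def iterLaurent (ε : ℤ) (𝒱 : VertexAlgebra V) (YW : V →ₗ[ℂ] VertexOperator ℂ W) (u v : V) (w : W)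
    (l : W →ₗ[ℂ] ℂ) (t : ℤ) : LaurentSeries ℂ :=
  HahnSeries.ofSuppBddBelow (fun j => l (iterSeries 𝒱 YW u v w j (t + j * (ε - 1)))) <| by
    obtain ⟨N, hN⟩ := exists_coeff_eq_zero (𝒱.Y u) v
    refine ⟨N, fun j hj => ?_⟩
    by_contra h
    exact hj (by
      simp only [iterSeries, hN j (by omega), map_zero, Pi.zero_apply, LinearMap.zero_apply])

lemma coeff_iterLaurent (YW : V →ₗ[ℂ] VertexOperator ℂ W) (u v : V) (w : W)
    (l : W →ₗ[ℂ] ℂ) (t j : ℤ) :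
    (iterLaurent ε 𝒱 YW u v w l t).coeff j
      = l (HVertexOperator.coeff (YW (HVertexOperator.coeff (𝒱.Y u) j v)) (t + j * (ε - 1)) w) :=
  rfl

/-- The part of `l (A(z₁) B(z₂) w)` of total degree `t` in `z₁, z₂`, divided by `z₂ ^ t` and written as
a series in `y = z₁ / z₂`. -/
def prodDiag (A B : VertexOperator ℂ W) (w : W) (l : W →ₗ[ℂ] ℂ) (t : ℤ) : ℤ → ℂ :=
  fun m => l (HVertexOperator.coeff A m (HVertexOperator.coeff B (t - m) w))

/-- The axiom `assoc`, separated into the homogeneous components: `(g(x) - 1) ^ k G(x) = f(g(x))` with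
the Laurent polynomial `f(y) = (y - 1) ^ k P(y)`. -/
lemma exists_one_variable_relation (𝒲 : PhiModule ε 𝒱 W) (u v : V) :
    ∃ k : ℕ, ∀ (w : W) (l : W →ₗ[ℂ] ℂ) (t : ℤ),
      (mulSubOne^[k] (prodDiag (𝒲.YW u) (𝒲.YW v) w l t)).support.Finite ∧
      HahnSeries.ofPowerSeries ℤ ℂ ((flow ((ε : ℂ) - 1) 1 - 1) ^ k)
          * iterLaurent ε 𝒱 𝒲.YW u v w l t
        = HahnSeries.ofPowerSeries ℤ ℂ (flowEval ((ε : ℂ) - 1)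
            (mulSubOne^[k] (prodDiag (𝒲.YW u) (𝒲.YW v) w l t))) := by
  obtain ⟨k, h1, h2⟩ := 𝒲.assoc u v
  refine ⟨k, fun w l t => ?_⟩
  set F := mulSub^[k] (prodSeries (𝒲.YW u) (𝒲.YW v) w) with hF
  have hf : mulSubOne^[k] (prodDiag (𝒲.YW u) (𝒲.YW v) w l t) = fun m => l (F m (t + k - m)) := by
    funext m
    rw [hF, iterate_mulSub]
    rfl
  have hfin : (Function.support fun m => F m (t + k - m)).Finite := by
    obtain ⟨N, hN⟩ := h1 w
    refine (Set.finite_Icc N (t + k - N)).subset fun m hm => ?_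
    by_contra h
    refine hm (hN _ _ ?_)
    simp only [Set.mem_Icc, not_and_or, not_le] at h
    omega
  have hfin' : (Function.support fun m => l (F m (t + k - m))).Finite :=
    hfin.subset fun m hm h => hm (by simp only [h, map_zero])
  rw [hf]
  refine ⟨hfin', ?_⟩
  ext j
  have hs : (Function.support fun i : ℕ => coeff i ((flow ((ε : ℂ) - 1) 1 - 1) ^ k) •
      iterSeries 𝒱 𝒲.YW u v w (j - i) (t + (j - i) * (ε - 1))).Finite := by
    obtain ⟨N, hN⟩ := exists_coeff_eq_zero (𝒱.Y u) v
    refine (Set.finite_Iic (j - N).toNat).subset fun i hi => ?_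
    by_contra h
    simp only [Set.mem_Iic, not_le] at h
    exact hi (by
      simp only [iterSeries, hN (j - i) (by omega), map_zero, Pi.zero_apply, LinearMap.zero_apply,
        smul_zero])
  have hl := l.toAddMonoidHom.map_finsum hs
  rw [← scalarMul_phi_sub_pow, h2 w] at hl
  simp only [LinearMap.toAddMonoidHom_coe, map_smul, smul_eq_mul] at hl
  rw [coeff_ofPowerSeries_mul]
  simp only [coeff_iterLaurent]
  refine hl.symm.trans ?_
  rw [PowerSeries.coeff_coe]
  split_ifs with hj
  · rw [substPhi_of_neg _ _ hj, map_zero]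
  · obtain ⟨n, rfl⟩ : ∃ n : ℕ, j = n := ⟨j.toNat, by omega⟩
    rw [substPhi_natCast, Int.natAbs_natCast, flowEval]
    have e1 := l.toAddMonoidHom.map_finsum (f := fun m : ℤ =>
      coeff n (flow ((ε : ℂ) - 1) m) • F m (t + k - m))
      (hfin.subset fun m hm h => hm (by simp only [h, smul_zero]))
    have e2 := (coeff n : ℂ⟦X⟧ →ₗ[ℂ] ℂ).toAddMonoidHom.map_finsum
      (finite_support_smul_flow hfin' ((ε : ℂ) - 1))
    simp only [LinearMap.toAddMonoidHom_coe, map_smul, smul_eq_mul] at e1 e2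
    rw [e1, e2]
    exact finsum_congr fun m => mul_comm _ _

lemma flow_one_sub_one_ne_zero (d : ℂ) : flow d 1 - 1 ≠ 0 := by
  intro h
  have := congrArg (coeff 1) h
  simp [coeff_flow, coeff_one] at this

/-- The coefficients of `Y_W(Y(a, z₀) 𝟏, z₂) = Y_W(a, φ_ε(z₂, z₀))`. This is `assoc` for the pair `a, 𝟏`,
with the factor `(φ_ε(z₂, z₀) - z₂) ^ k` cancelled. -/
lemma coeff_YW_coeff_vac (𝒲 : PhiModule ε 𝒱 W) (a : V) (j : ℕ) (t : ℤ) (w : W) :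
    HVertexOperator.coeff (𝒲.YW (HVertexOperator.coeff (𝒱.Y a) j 𝒱.vac)) (t + j * (ε - 1)) w
      = coeff j (flow ((ε : ℂ) - 1) t) • HVertexOperator.coeff (𝒲.YW a) t w := by
  rw [← sub_eq_zero, ← Module.forall_dual_apply_eq_zero_iff ℂ]
  intro l
  rw [map_sub, sub_eq_zero, map_smul, smul_eq_mul]
  obtain ⟨k, hk⟩ := exists_one_variable_relation 𝒲 a 𝒱.vac
  obtain ⟨-, h2⟩ := hk w l t
  have hv (n : ℤ) : HVertexOperator.coeff (𝒲.YW 𝒱.vac) n w = if n = 0 then w else 0 := by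
    rw [HVertexOperator.coeff_apply_apply, 𝒲.vacuum]
    simp [HahnSeries.coeff_single]
  have hP : prodDiag (𝒲.YW a) (𝒲.YW 𝒱.vac) w l t
      = Pi.single t (l (HVertexOperator.coeff (𝒲.YW a) t w)) := by
    funext m
    rw [prodDiag, hv]
    by_cases h : m = t
    · subst h; simp
    · rw [if_neg (by omega), map_zero, map_zero, Pi.single_eq_of_ne h]
  have hfin : (prodDiag (𝒲.YW a) (𝒲.YW 𝒱.vac) w l t).support.Finite := by
    rw [hP]
    exact (Set.finite_singleton t).subset Pi.support_single_subset
  rw [flowEval_iterate_mulSubOne hfin, map_mul] at h2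
  have hne : HahnSeries.ofPowerSeries ℤ ℂ ((flow ((ε : ℂ) - 1) 1 - 1) ^ k) ≠ 0 := by
    rw [Ne, ← map_zero (HahnSeries.ofPowerSeries ℤ ℂ),
      HahnSeries.ofPowerSeries_injective.eq_iff]
    exact pow_ne_zero _ (flow_one_sub_one_ne_zero _)
  have h3 := congrArg (fun G => HahnSeries.coeff G (j : ℤ)) (mul_left_cancel₀ hne h2)
  simp only [coeff_iterLaurent] at h3
  rw [LaurentSeries.coeff_coe_powerSeries, hP, flowEval, finsum_eq_single _ t] at h3
  · rw [h3, Pi.single_eq_same, map_smul, smul_eq_mul, mul_comm]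
  · intro m hm
    rw [Pi.single_eq_of_ne hm, zero_smul]

lemma choose_neg_one (i : ℕ) : Ring.choose (-1 : ℤ) i = (-1) ^ i := by
  induction i with
  | zero => simp
  | succ i ih =>
    have h := Ring.choose_succ_succ (-1 : ℤ) i
    rw [neg_add_cancel, Ring.choose_zero_succ, ih] at h
    rw [pow_succ]
    linarith

/-- Skew-symmetry `Y(u, z₀) v = e ^ (z₀ D) Y(v, -z₀) u`, where `e ^ (z₀ D) a = Y(a, z₀) 𝟏`. It is the
Jacobi identity on `𝟏` at `m = -1`, `n = 0`. -/
lemma coeff_skew_symmetry (𝒱 : VertexAlgebra V) (u v : V) (j : ℤ) :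
    HVertexOperator.coeff (𝒱.Y u) j v = ∑ᶠ i : ℕ, (Int.negOnePow (j - i) : ℤ) •
      HVertexOperator.coeff (𝒱.Y (HVertexOperator.coeff (𝒱.Y v) (j - i) u)) i 𝒱.vac := by
  have h := 𝒱.jacobi v u 𝒱.vac (-j - 1) (-1) 0
  rw [finsum_eq_zero_of_forall_eq_zero, finsum_eq_single _ 0, zero_sub] at h
  · have hs : (Function.support fun i : ℕ => Ring.choose (-1 : ℤ) i • VertexOperator.ncoeff
        (𝒱.Y (VertexOperator.ncoeff (𝒱.Y v) (-j - 1 + i) u)) (-1 + 0 - i) 𝒱.vac).Finite := by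
      obtain ⟨N, hN⟩ := exists_coeff_eq_zero (𝒱.Y v) u
      refine (Set.finite_Iic (j - N).toNat).subset fun i hi => ?_
      by_contra h
      simp only [Set.mem_Iic, not_le] at h
      refine hi ?_
      simp only [VertexOperator.ncoeff_apply]
      rw [hN (-(-j - 1 + i) - 1) (by omega)]
      simp
    have h' := congrArg (fun x => (-(Int.negOnePow (-j - 1) : ℤ)) • x) h
    rw [smul_finsum' _ hs] at h'
    have hsq : (Int.negOnePow (-j - 1) : ℤ) * (Int.negOnePow (-j - 1) : ℤ) = 1 := by
      rw [← Units.val_mul, Int.units_mul_self, Units.val_one]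
    have hc : VertexOperator.ncoeff (𝒱.Y v) (-1 + (0 : ℕ)) 𝒱.vac = v := by
      simpa using 𝒱.creation_const v
    rw [hc] at h'
    simp only [smul_neg, neg_mul, neg_smul, neg_neg, smul_smul, pow_zero, one_mul, Ring.choose_zero_right,
      hsq, one_smul, VertexOperator.ncoeff_apply] at h'
    have e : -((0 : ℤ) + (-j - 1) - (0 : ℕ)) - 1 = j := by push_cast; ring
    rw [e] at h'
    rw [h']
    refine finsum_congr fun i => ?_
    have e1 : -(-j - 1 + (i : ℤ)) - 1 = j - i := by ring
    have e2 : -(-1 + 0 - (i : ℤ)) - 1 = i := by ring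
    rw [e1, e2, ← neg_smul]
    congr 1
    rw [choose_neg_one, Int.negOnePow_sub, Int.negOnePow_sub, Int.negOnePow_neg]
    simp [Int.negOnePow]
  · intro i hi
    rw [𝒱.creation v _ (by omega), map_zero, smul_zero]
  · intro i
    rw [𝒱.creation u _ (by omega), map_zero, smul_zero]

/-! ### Locality and the residue formula -/

/-- The one-variable form of skew-symmetry, `G^{uv} = g ^ t G^{vu}(reversal d)`. -/
lemma coeff_iterLaurent_swap (𝒲 : PhiModule ε 𝒱 W) (u v : V) (w : W) (l : W →ₗ[ℂ] ℂ) (t j : ℤ) :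
    (iterLaurent ε 𝒱 𝒲.YW u v w l t).coeff j
      = ∑ᶠ i : ℕ, (Int.negOnePow (j - i) : ℤ)
          * coeff i (flow ((ε : ℂ) - 1) (t + (j - i : ℤ) * ((ε : ℂ) - 1)))
          * (iterLaurent ε 𝒱 𝒲.YW v u w l t).coeff (j - i) := by
  let L : V →ₗ[ℂ] ℂ := l ∘ₗ LinearMap.applyₗ w ∘ₗ
    LinearMap.proj (φ := fun _ : ℤ => Module.End ℂ W) (t + j * (ε - 1)) ∘ₗ
      HVertexOperator.coeff ∘ₗ 𝒲.YW
  have hL (x : V) : L x = l (HVertexOperator.coeff (𝒲.YW x) (t + j * (ε - 1)) w) := rfl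
  have hs : (Function.support fun i : ℕ => (Int.negOnePow (j - i) : ℤ) •
      HVertexOperator.coeff (𝒱.Y (HVertexOperator.coeff (𝒱.Y v) (j - i) u)) i 𝒱.vac).Finite := by
    obtain ⟨N, hN⟩ := exists_coeff_eq_zero (𝒱.Y v) u
    refine (Set.finite_Iic (j - N).toNat).subset fun i hi => ?_
    by_contra h
    simp only [Set.mem_Iic, not_le] at h
    refine hi ?_
    simp only [hN (j - i) (by omega), map_zero, Pi.zero_apply, LinearMap.zero_apply, smul_zero]
  have h := L.toAddMonoidHom.map_finsum hs
  rw [← coeff_skew_symmetry] at h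
  simp only [LinearMap.toAddMonoidHom_coe, map_zsmul, hL] at h
  rw [coeff_iterLaurent, h]
  refine finsum_congr fun i => ?_
  have e : t + j * (ε - 1) = (t + (j - i) * (ε - 1)) + i * (ε - 1) := by ring
  rw [e, coeff_YW_coeff_vac, coeff_iterLaurent, map_smul, zsmul_eq_mul, smul_eq_mul, mul_assoc]
  push_cast
  rfl

lemma iterate_mulSubOne_reflect (P : ℤ → ℂ) (t : ℤ) (k : ℕ) (m : ℤ) :
    mulSubOne^[k] (fun m => P (t - m)) m = (-1) ^ k * mulSubOne^[k] P (t + k - m) := by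
  induction k generalizing m with
  | zero => simp
  | succ k ih =>
    rw [Function.iterate_succ_apply', Function.iterate_succ_apply', mulSubOne, mulSubOne, ih, ih,
      show t + (k + 1 : ℕ) - m = t + k - (m - 1) by push_cast; ring,
      show t + k - (m - 1) - 1 = t + k - m by ring]
    ring

/-- Locality: multiplied by a power of `y - 1`, the series of `Y_W(u, z₁) Y_W(v, z₂)` and of
`Y_W(v, z₂) Y_W(u, z₁)` become the same Laurent polynomial, which also describes
`Y_W(Y(u, z₀) v, z₂)`. -/
lemma exists_common_relation (𝒲 : PhiModule ε 𝒱 W) (u v : V) (w : W) (l : W →ₗ[ℂ] ℂ) (t : ℤ) :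
    ∃ (K : ℕ) (f : ℤ → ℂ), f.support.Finite ∧
      mulSubOne^[K] (prodDiag (𝒲.YW u) (𝒲.YW v) w l t) = f ∧
      mulSubOne^[K] (fun m => prodDiag (𝒲.YW v) (𝒲.YW u) w l t (t - m)) = f ∧
      HahnSeries.ofPowerSeries ℤ ℂ ((flow ((ε : ℂ) - 1) 1 - 1) ^ K)
          * iterLaurent ε 𝒱 𝒲.YW u v w l t
        = HahnSeries.ofPowerSeries ℤ ℂ (flowEval ((ε : ℂ) - 1) f) := by
  obtain ⟨k₁, h₁⟩ := exists_one_variable_relation 𝒲 u v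
  obtain ⟨k₂, h₂⟩ := exists_one_variable_relation 𝒲 v u
  obtain ⟨hf₁, h₁⟩ := h₁ w l t
  obtain ⟨hf₂, h₂⟩ := h₂ w l t
  have h₃ := reversed_relation hf₂ (coeff_iterLaurent_swap 𝒲 u v w l t) h₂
  simp only [← iterate_mulSubOne_reflect] at h₃
  have hf₃ : (mulSubOne^[k₂] fun m => prodDiag (𝒲.YW v) (𝒲.YW u) w l t (t - m)).support.Finite := by
    have h4 : (Function.support fun m => mulSubOne^[k₂] (prodDiag (𝒲.YW v) (𝒲.YW u) w l t)
        (t + k₂ - m)).Finite := hf₂.preimage (sub_right_injective.injOn (s := _))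
    refine h4.subset fun m hm h => hm ?_
    simp only at h
    rw [iterate_mulSubOne_reflect, h, mul_zero]
  have hfin := finite_support_iterate_mulSubOne hf₁ k₂
  have e₁ : HahnSeries.ofPowerSeries ℤ ℂ ((flow ((ε : ℂ) - 1) 1 - 1) ^ (k₁ + k₂))
      * iterLaurent ε 𝒱 𝒲.YW u v w l t = HahnSeries.ofPowerSeries ℤ ℂ (flowEval ((ε : ℂ) - 1)
        (mulSubOne^[k₂] (mulSubOne^[k₁] (prodDiag (𝒲.YW u) (𝒲.YW v) w l t)))) := by
    rw [flowEval_iterate_mulSubOne hf₁, map_mul _ _ (flowEval _ _), ← h₁, pow_add, map_mul]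
    ring
  have e₂ : HahnSeries.ofPowerSeries ℤ ℂ ((flow ((ε : ℂ) - 1) 1 - 1) ^ (k₁ + k₂))
      * iterLaurent ε 𝒱 𝒲.YW u v w l t = HahnSeries.ofPowerSeries ℤ ℂ (flowEval ((ε : ℂ) - 1)
        (mulSubOne^[k₁] (mulSubOne^[k₂]
          fun m => prodDiag (𝒲.YW v) (𝒲.YW u) w l t (t - m)))) := by
    rw [flowEval_iterate_mulSubOne hf₃, map_mul _ _ (flowEval _ _), ← h₃, pow_add, map_mul]
    ring
  -- Evaluation at `g` is injective on Laurent polynomials, so `e₁` and `e₂` give the same one.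
  refine ⟨k₁ + k₂, _, hfin, ?_, ?_, e₁⟩
  · rw [add_comm, Function.iterate_add_apply]
  · rw [Function.iterate_add_apply]
    exact flowEval_injective (finite_support_iterate_mulSubOne hf₃ k₁) hfin _
      (HahnSeries.ofPowerSeries_injective (e₂.symm.trans e₁))

lemma halfSum_zero (P Q : ℤ → ℂ) :
    halfSum P Q 0 = (∑ᶠ m : ℕ, P m) + ∑ᶠ m : ℕ, Q (-m - 1) := by
  simp [halfSum]

lemma map_normalOrderCoeff (A B : VertexOperator ℂ W) (w : W) (l : W →ₗ[ℂ] ℂ) (t : ℤ) :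
    l (normalOrderCoeff A B t w)
      = halfSum (prodDiag A B w l t) (fun m => prodDiag B A w l t (t - m)) 0 := by
  have h1 := l.toAddMonoidHom.map_finsum (finite_support_fst A B t w)
  have h2 := l.toAddMonoidHom.map_finsum (finite_support_snd A B t w)
  simp only [LinearMap.toAddMonoidHom_coe] at h1 h2
  rw [halfSum_zero]
  change l (_ + _) = _
  rw [map_add, h1, h2]
  congr 1
  refine finsum_congr fun m => ?_
  rw [prodDiag, show t - (-m - 1) = t + m + 1 by ring, show t - (t + m + 1) = -(m : ℤ) - 1 by ring]

/-- The normally ordered product is the residue in `x` of `g' / (g - 1)` times the series of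
`Y_W(Y(u, z₀) v, z₂)`. -/
lemma map_normalOrderCoeff_eq_coeff_zero (𝒲 : PhiModule ε 𝒱 W) (u v : V) (w : W) (l : W →ₗ[ℂ] ℂ)
    (t : ℤ) :
    l (normalOrderCoeff (𝒲.YW u) (𝒲.YW v) t w)
      = (HahnSeries.ofPowerSeries ℤ ℂ
          (derivative ℂ (flow ((ε : ℂ) - 1) 1) * (flowQuot ((ε : ℂ) - 1))⁻¹)
          * iterLaurent ε 𝒱 𝒲.YW u v w l t).coeff 0 := by
  obtain ⟨K, f, hf, hP, hQ, h⟩ := exists_common_relation 𝒲 u v w l t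
  obtain ⟨N, hN⟩ := exists_coeff_eq_zero (𝒲.YW v) w
  obtain ⟨M, hM⟩ := exists_coeff_eq_zero (𝒲.YW u) w
  rw [coeff_zero_eq_finsum_choose hf h, ← halfSum_self hf, map_normalOrderCoeff,
    ← halfSum_iterate_mulSubOne (N := t - N) (N' := M) _ _ K, hP, hQ]
  · intro m hm
    rw [prodDiag, hN _ (by omega), map_zero, map_zero]
  · intro m hm
    rw [prodDiag, hM _ (by omega), map_zero, map_zero]

lemma coeff_YW_ncoeff_neg_one (𝒲 : PhiModule ε 𝒱 W) (u v : V) (w : W) (l : W →ₗ[ℂ] ℂ) (p : ℤ) :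
    l (HVertexOperator.coeff (𝒲.YW (VertexOperator.ncoeff (𝒱.Y u) (-1) v)) p w)
      = l (normalOrderCoeff (𝒲.YW u) (𝒲.YW v) p w)
        - ∑ᶠ n : ℕ, (∑ i ∈ range (n + 2),
            (1 / (i.factorial : ℂ)) * epsFac ε i * hCoeff ε (n + 1 - i)) *
              l (HVertexOperator.coeff (𝒲.YW (VertexOperator.ncoeff (𝒱.Y u) (n : ℤ) v))
                (p - ((n : ℤ) + 1) * (ε - 1)) w) := by
  have hs : ∃ B : ℕ, ∀ n : ℕ, B ≤ n → (iterLaurent ε 𝒱 𝒲.YW u v w l p).coeff (0 - n) = 0 := by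
    obtain ⟨N, hN⟩ := exists_coeff_eq_zero (𝒱.Y u) v
    refine ⟨(-N).toNat + 1, fun n hn => ?_⟩
    rw [coeff_iterLaurent, hN _ (by omega)]
    simp only [map_zero, Pi.zero_apply, LinearMap.zero_apply]
  obtain ⟨B, hB⟩ := hs
  have h (n : ℕ) : l (HVertexOperator.coeff (𝒲.YW (VertexOperator.ncoeff (𝒱.Y u) (n : ℤ) v))
      (p - ((n : ℤ) + 1) * (ε - 1)) w)
        = (iterLaurent ε 𝒱 𝒲.YW u v w l p).coeff (0 - (n + 1 : ℕ)) := by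
    rw [coeff_iterLaurent, VertexOperator.ncoeff_apply]
    rw [show 0 - ((n + 1 : ℕ) : ℤ) = -n - 1 by push_cast; ring,
      show p + (-(n : ℤ) - 1) * (ε - 1) = p - ((n : ℤ) + 1) * (ε - 1) by ring]
  have h0 : l (HVertexOperator.coeff (𝒲.YW (VertexOperator.ncoeff (𝒱.Y u) (-1) v)) p w)
      = (iterLaurent ε 𝒱 𝒲.YW u v w l p).coeff (0 - (0 : ℕ)) := by
    rw [coeff_iterLaurent, VertexOperator.ncoeff_apply]
    simp
  simp only [h, h0]
  rw [map_normalOrderCoeff_eq_coeff_zero, coeff_ofPowerSeries_mul,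
    finsum_eq_sum_range (B := B + 1), finsum_eq_sum_range (B := B), sum_range_succ']
  · simp only [coeff_derivative_flow_mul_inv]
    simp [epsFac, hCoeff_zero]
  · intro n hn
    rw [hB _ (by omega), mul_zero]
  · intro n hn
    rw [hB _ (by omega), mul_zero]

end PhiCoord

end

theorem proposition4p5 (ε : ℤ)
    {V : Type*} [AddCommGroup V] [Module ℂ V] (𝒱 : PhiCoord.VertexAlgebra V)
    {W : Type*} [AddCommGroup W] [Module ℂ W] (𝒲 : PhiCoord.PhiModule ε 𝒱 W) (u v : V) :
    𝒲.YW (VertexOperator.ncoeff (𝒱.Y u) (-1) v)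
      = PhiCoord.normalOrder (𝒲.YW u) (𝒲.YW v)
        - ∑ᶠ n : ℕ, ∑ i ∈ Finset.range (n + 2),
            ((1 / (i.factorial : ℂ)) * PhiCoord.epsFac ε i * PhiCoord.hCoeff ε (n + 1 - i)) •
              PhiCoord.zpowMul (((n : ℤ) + 1) * (ε - 1))
                (𝒲.YW (VertexOperator.ncoeff (𝒱.Y u) (n : ℤ) v)) := by
  apply HVertexOperator.coeff_inj
  funext p
  ext w
  rw [← sub_eq_zero, ← Module.forall_dual_apply_eq_zero_iff ℂ]
  intro l
  rw [map_sub, sub_eq_zero, PhiCoord.coeff_YW_ncoeff_neg_one, map_sub]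
  let L : VertexOperator ℂ W →ₗ[ℂ] ℂ := l ∘ₗ LinearMap.applyₗ w ∘ₗ
    LinearMap.proj (φ := fun _ : ℤ => Module.End ℂ W) p ∘ₗ HVertexOperator.coeff
  have hL (A : VertexOperator ℂ W) : L A = l (HVertexOperator.coeff A p w) := rfl
  have hz (k : ℤ) (A : VertexOperator ℂ W) :
      HVertexOperator.coeff (PhiCoord.zpowMul k A) p w = HVertexOperator.coeff A (p - k) w := rfl
  have hs : (Function.support fun n : ℕ => ∑ i ∈ Finset.range (n + 2),
      ((1 / (i.factorial : ℂ)) * PhiCoord.epsFac ε i * PhiCoord.hCoeff ε (n + 1 - i)) •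
        PhiCoord.zpowMul (((n : ℤ) + 1) * (ε - 1))
          (𝒲.YW (VertexOperator.ncoeff (𝒱.Y u) (n : ℤ) v))).Finite := by
    obtain ⟨N, hN⟩ := PhiCoord.exists_coeff_eq_zero (𝒱.Y u) v
    refine (Set.finite_Iic (-N).toNat).subset fun n hn => ?_
    by_contra h
    simp only [Set.mem_Iic, not_le] at h
    refine hn (Finset.sum_eq_zero fun i _ => ?_)
    have h0 : PhiCoord.zpowMul (((n : ℤ) + 1) * (ε - 1)) (0 : VertexOperator ℂ W) = 0 := rfl
    rw [VertexOperator.ncoeff_apply, hN _ (by omega), map_zero, h0, smul_zero]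
  have h := L.toAddMonoidHom.map_finsum hs
  simp only [LinearMap.toAddMonoidHom_coe, map_sum, map_smul, Pi.smul_apply,
    LinearMap.smul_apply, hL, hz, smul_eq_mul, ← Finset.sum_mul] at h
  rw [← h]
  change _ = l (HVertexOperator.coeff (PhiCoord.normalOrder _ _) p w - _)
  rw [map_sub]
  rfl
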